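/- Let $\Phi$ be the standard normal distribution function and $\|Z\|_p=(\mathbb{E}|Z|^p)^{1/p}$. Call a real number $c$ a Berry–Esseen constant if, for every $n\ge 1$, all i.i.d. centered real random variables $Z_1,\dots,Z_n$ with $\mathbb{E}|Z_1|^3<\infty$ and $\sigma_Z^2=\operatorname{Var}(Z_1)>0$, and every $x\in\mathbb{R}$, $$\left|\mathbb{P}\left(\frac{\sqrt n\,\overline Z}{\sigma_Z}\le x\right)-\Phi(x)\right|\le c\,\frac{\mathbb{E}|Z_1|^3}{\sigma_Z^3\sqrt n},\qquad \overline Z=\frac1n\sum_{i=1}^n Z_i .$$ Such a constant exists. Let $c_{BE}$ be any such constant. Let $(X,Y)$ be a couple of real random variables, with $\mu_X=\mathbb{E}X$, $\mu_Y=\mathbb{E}Y$, $\tilde X=X-\mu_X$, $\tau=\operatorname{Cov}(Y,X)/\operatorname{Var}(X)$, $\varepsilon=(Y-\mu_Y)-\tau\tilde X$, $\sigma_X^2=\operatorname{Var}(X)$, $\sigma_\varepsilon^2=\operatorname{Var}(\varepsilon)$. Assume that $X$, $Y$ and $\tilde X\varepsilon$ have finite third absolute moments and that $\tilde X\varepsilon$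 is not almost surely zero (so that $\sigma_X,\sigma_\varepsilon>0$). Put $$K_1(X,Y)=\frac{\sigma_\varepsilon\sigma_X}{\sqrt{2\pi}\,\|\tilde X\varepsilon\|_2},\qquad K_2(X,Y)=2+c_{BE}\left[\frac{\|\tilde X\varepsilon\|_3^3}{\|\tilde X\varepsilon\|_2^3}+\frac{2\|\varepsilon\|_3^3}{\sigma_\varepsilon^3}+\frac{2\|\tilde X\|_3^3}{\sigma_X^3}\right].$$ Let $n\ge1$, let $(X_1,Y_1),\dots,(X_n,Y_n)$ be independent copies of $(X,Y)$, $\overline X=\frac1n\sum_{i=1}^nX_i$ and $\varepsilon_i=(Y_i-\mu_Y)-\tau(X_i-\mu_X)$. Then $$\sup_{x\in\mathbb{R}}\left|\mathbb{P}\left(\frac{\sum_{i=1}^n(X_i-\overline X)\varepsilon_i}{\sqrt{n\|\tilde X\varepsilon\|_2^2}}\le x\right)-\Phi(x)\right|\le\frac{\log n}{\sqrt n}K_1(X,Y)+\frac{K_2(X,Y)}{\sqrt n}.$$ -/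

import Mathlib

open MeasureTheory ProbabilityTheory

/-- The cumulative distribution function of the standard Gaussian law. -/
noncomputable def stdNormalCDF (x : ℝ) : ℝ := cdf (gaussianReal 0 1) x

/-- `c` is an admissible constant in the Berry-Esseen inequality: for all `n ≥ 1`, all i.i.d.
centered non-degenerate `Z₁, …, Zₙ` with a finite third absolute moment and all real `x`,
`|P(√n Z̄ / σ ≤ x) - Φ(x)| ≤ c E|Z₁|³ / (σ³ √n)`, where `σ² = Var Z₁`. -/
def IsBerryEsseenConstant (c : ℝ) : Prop :=
  ∀ (Ω : Type) [MeasurableSpace Ω] (P : Measure Ω) [IsProbabilityMeasure P]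
    (n : ℕ) (hn : 0 < n) (Z : Fin n → Ω → ℝ),
    iIndepFun Z P →
    (∀ i j, IdentDistrib (Z i) (Z j) P P) →
    (∀ i, MemLp (Z i) 3 P) →
    (∀ i, ∫ ω, Z i ω ∂P = 0) →
    0 < Var[Z ⟨0, hn⟩; P] →
    ∀ x : ℝ,
      |P.real {ω | √(n : ℝ) * ((∑ i, Z i ω) / n) / √Var[Z ⟨0, hn⟩; P] ≤ x} - stdNormalCDF x|
        ≤ c * (∫ ω, |Z ⟨0, hn⟩ ω| ^ 3 ∂P) / (√Var[Z ⟨0, hn⟩; P] ^ 3 * √(n : ℝ))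

section Regression

variable {Ω : Type*} [MeasurableSpace Ω]

/-- The standard deviation `σ_Z`. -/
noncomputable def stdDev (Z : Ω → ℝ) (P : Measure Ω) : ℝ := √Var[Z; P]

/-- The centered variable `Z - E Z`. -/
noncomputable def centered (Z : Ω → ℝ) (P : Measure Ω) : Ω → ℝ :=
  fun ω => Z ω - ∫ ω', Z ω' ∂P

/-- The regression slope `τ = Cov(Y, X) / Var X`. -/
noncomputable def regressionSlope (X Y : Ω → ℝ) (P : Measure Ω) : ℝ :=
  cov[Y, X; P] / Var[X; P]

/-- The error `(y - E Y) - τ (x - E X)` at the point `(x, y)`, with `E X`, `E Y` and `τ` computed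
from the couple `(X, Y)`. At `(X, Y)` this is `ε`; at the copy `(X_i, Y_i)` this is `ε_i`. -/
noncomputable def errorAt (X Y : Ω → ℝ) (P : Measure Ω) (x y : ℝ) : ℝ :=
  (y - ∫ ω, Y ω ∂P) - regressionSlope X Y P * (x - ∫ ω, X ω ∂P)

/-- The error variable `ε` of the couple `(X, Y)`. -/
noncomputable def regressionError (X Y : Ω → ℝ) (P : Measure Ω) : Ω → ℝ :=
  fun ω => errorAt X Y P (X ω) (Y ω)

/-- The product of the centered `X` and the error `ε`. -/
noncomputable def centeredMulError (X Y : Ω → ℝ) (P : Measure Ω) : Ω → ℝ :=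
  fun ω => centered X P ω * regressionError X Y P ω

/-- `K₁(X, Y)`. -/
noncomputable def momentK₁ (X Y : Ω → ℝ) (P : Measure Ω) : ℝ :=
  stdDev (regressionError X Y P) P * stdDev X P /
    (√(2 * Real.pi) * lpNorm (centeredMulError X Y P) 2 P)

/-- `K₂(X, Y)`, for the value `c` of the Berry-Esseen constant. -/
noncomputable def momentK₂ (c : ℝ) (X Y : Ω → ℝ) (P : Measure Ω) : ℝ :=
  2 + c * (lpNorm (centeredMulError X Y P) 3 P ^ 3 / lpNorm (centeredMulError X Y P) 2 P ^ 3
    + 2 * lpNorm (regressionError X Y P) 3 P ^ 3 / stdDev (regressionError X Y P) P ^ 3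
    + 2 * lpNorm (centered X P) 3 P ^ 3 / stdDev X P ^ 3)

end Regression

/-- The empirical mean of a finite sample. -/
noncomputable def sampleMean {n : ℕ} (x : Fin n → ℝ) : ℝ := (∑ i, x i) / n

/-! Write `X̃ᵢ` for the copies of the centered `X`. Centering at the true mean gives `∑ (Xᵢ - X̄) εᵢ
= ∑ X̃ᵢ εᵢ - (∑ X̃ᵢ)(∑ εᵢ) / n` (`sum_sub_sampleMean_mul`). The slope makes `X̃ε` centered, so the
normalized first sum obeys Berry-Esseen. The normalized second term is `σ_X σ_ε / (‖X̃ε‖₂ √n)` times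
`G H`, where `G` and `H` are the standardized sums of `X̃ᵢ` and `εᵢ`. Unless `|G|` or `|H|` exceeds
`√(log n)`, it moves the argument of `Φ` by at most `√(2π) K₁ log n / √n`, and `Φ` is
`1/√(2π)`-Lipschitz. Each of the two exceptional events has probability at most `1/√n` plus twice a
Berry-Esseen error. These tails and the error of the first sum make up `K₂`.

That a Berry-Esseen constant exists is proved by Stein's method and induction on `n`. The indicator
of a half-line is replaced by a ramp of width `l`, whose Stein solution is expanded around the sum
with one term removed (`abs_integral_ramp_sum_sub_le`). The error involves the mass that this
shorter sum puts on short intervals, which the induction hypothesis controls. With `l` a suitable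
multiple of `γ / √n`, where `γ` is the third absolute moment, the recursion closes with constant 40.
-/

/-! ### Density, distribution function and tails of the standard Gaussian law. -/

lemma stdNormalCDF_eq_setIntegral (x : ℝ) :
    stdNormalCDF x = ∫ t in Set.Iic x, gaussianPDFReal 0 1 t := by
  rw [stdNormalCDF, cdf_eq_real, Measure.real, gaussianReal_apply_eq_integral 0 one_ne_zero,
    ENNReal.toReal_ofReal]
  exact integral_nonneg fun t => gaussianPDFReal_nonneg 0 1 t

lemma stdNormalPDF_eq (x : ℝ) :
    gaussianPDFReal 0 1 x = (√(2 * Real.pi))⁻¹ * Real.exp (-x ^ 2 / 2) := by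
  simp [gaussianPDFReal]

lemma stdNormalPDF_le (x : ℝ) : gaussianPDFReal 0 1 x ≤ 1 / √(2 * Real.pi) := by
  rw [stdNormalPDF_eq, one_div]
  refine mul_le_of_le_one_right (by positivity) (Real.exp_le_one_iff.2 ?_)
  nlinarith [sq_nonneg x]

lemma stdNormalCDF_nonneg (x : ℝ) : 0 ≤ stdNormalCDF x := cdf_nonneg _ x

lemma stdNormalCDF_le_one (x : ℝ) : stdNormalCDF x ≤ 1 := cdf_le_one _ x

lemma monotone_stdNormalCDF : Monotone stdNormalCDF := monotone_cdf _

lemma stdNormalCDF_sub_le {a b : ℝ} (hab : a ≤ b) :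
    stdNormalCDF b - stdNormalCDF a ≤ (b - a) / √(2 * Real.pi) := by
  have hi : Integrable (gaussianPDFReal 0 1) := integrable_gaussianPDFReal 0 1
  rw [stdNormalCDF_eq_setIntegral, stdNormalCDF_eq_setIntegral,
    intervalIntegral.integral_Iic_sub_Iic hi.integrableOn hi.integrableOn]
  have := intervalIntegral.integral_mono_on hab hi.intervalIntegrable
    (intervalIntegrable_const (μ := volume) (c := 1 / √(2 * Real.pi))) fun x _ => stdNormalPDF_le x
  rwa [intervalIntegral.integral_const, smul_eq_mul, mul_one_div] at this

lemma setIntegral_Ioi_stdNormalPDF (x : ℝ) :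
    ∫ t in Set.Ioi x, gaussianPDFReal 0 1 t = 1 - stdNormalCDF x := by
  have hi : Integrable (gaussianPDFReal 0 1) := integrable_gaussianPDFReal 0 1
  have := intervalIntegral.integral_Iic_add_Ioi (b := x) hi.integrableOn hi.integrableOn
  rw [integral_gaussianPDFReal_eq_one 0 one_ne_zero, ← stdNormalCDF_eq_setIntegral] at this
  linarith

lemma stdNormalCDF_neg (x : ℝ) : stdNormalCDF (-x) = 1 - stdNormalCDF x := by
  rw [← setIntegral_Ioi_stdNormalPDF, stdNormalCDF_eq_setIntegral,
    ← integral_comp_neg_Ioi]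
  simp only [stdNormalPDF_eq, neg_sq]

lemma stdNormalCDF_zero : stdNormalCDF 0 = 1 / 2 := by
  have := stdNormalCDF_neg 0
  rw [neg_zero] at this
  linarith

/-- Translate the upper tail to start at 0: for `u, t ≥ 0`, `(u + t)² ≥ u² + t²`, and the half-line
has mass `1/2`. -/
lemma stdNormalCDF_neg_le {t : ℝ} (ht : 0 ≤ t) :
    stdNormalCDF (-t) ≤ Real.exp (-t ^ 2 / 2) / 2 := by
  have hi : Integrable (gaussianPDFReal 0 1) := integrable_gaussianPDFReal 0 1
  have hs : ∫ u in Set.Ioi (0 : ℝ), gaussianPDFReal 0 1 (u + t) = 1 - stdNormalCDF t := by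
    have := (measurePreserving_add_right volume t).setIntegral_preimage_emb
      (MeasurableEquiv.addRight t).measurableEmbedding (gaussianPDFReal 0 1) (Set.Ioi t)
    rwa [Set.preimage_add_const_Ioi, sub_self, setIntegral_Ioi_stdNormalPDF] at this
  rw [stdNormalCDF_neg, ← hs]
  calc ∫ u in Set.Ioi (0 : ℝ), gaussianPDFReal 0 1 (u + t)
      ≤ ∫ u in Set.Ioi (0 : ℝ), Real.exp (-t ^ 2 / 2) * gaussianPDFReal 0 1 u := by
        refine setIntegral_mono_on (hi.comp_add_right t).integrableOn (hi.const_mul _).integrableOn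
          measurableSet_Ioi fun u hu => ?_
        rw [stdNormalPDF_eq, stdNormalPDF_eq, mul_left_comm, ← Real.exp_add]
        have : 0 ≤ u * t := mul_nonneg (le_of_lt hu) ht
        gcongr
        nlinarith
    _ = Real.exp (-t ^ 2 / 2) / 2 := by
        rw [integral_const_mul, setIntegral_Ioi_stdNormalPDF, stdNormalCDF_zero]; ring

lemma hasDerivAt_stdNormalPDF (x : ℝ) :
    HasDerivAt (gaussianPDFReal 0 1) (-x * gaussianPDFReal 0 1 x) x := by
  have h : gaussianPDFReal 0 1 = fun x => (√(2 * Real.pi))⁻¹ * Real.exp (-x ^ 2 / 2) :=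
    funext stdNormalPDF_eq
  rw [h]
  refine (((hasDerivAt_pow 2 x).neg.div_const 2).exp.const_mul (√(2 * Real.pi))⁻¹).congr_deriv ?_
  simp
  ring

/-- The Mills ratio bound. -/
lemma mul_stdNormalCDF_neg_le {t : ℝ} (ht : 0 ≤ t) :
    t * stdNormalCDF (-t) ≤ gaussianPDFReal 0 1 t := by
  have hi : Integrable (gaussianPDFReal 0 1) := integrable_gaussianPDFReal 0 1
  have hlim : Filter.Tendsto (gaussianPDFReal 0 1) Filter.atTop (nhds 0) :=
    tendsto_zero_of_hasDerivAt_of_integrableOn_Ioi (a := t)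
      (fun x _ => hasDerivAt_stdNormalPDF x) (by
        have : Integrable fun x : ℝ => -x * gaussianPDFReal 0 1 x := by
          have := (integrable_mul_exp_neg_mul_sq (b := 1 / 2) (by norm_num)).const_mul
            (-(√(2 * Real.pi))⁻¹)
          refine this.congr (Filter.Eventually.of_forall fun x => ?_)
          simp only [stdNormalPDF_eq]
          rw [show -x ^ 2 / 2 = -(1 / 2) * x ^ 2 by ring]; ring
        exact this.integrableOn) hi.integrableOn
  have hd : ∀ x ∈ Set.Ici t, HasDerivAt (gaussianPDFReal 0 1) (-x * gaussianPDFReal 0 1 x) x :=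
    fun x _ => hasDerivAt_stdNormalPDF x
  have hneg : ∀ x ∈ Set.Ioi t, -x * gaussianPDFReal 0 1 x ≤ 0 := fun x hx => by
    have := gaussianPDFReal_nonneg 0 1 x
    have hx' : t < x := hx
    nlinarith
  have hint := integrableOn_Ioi_deriv_of_nonpos' hd hneg hlim
  have hval := integral_Ioi_of_hasDerivAt_of_nonpos' hd hneg hlim
  rw [stdNormalCDF_neg, ← setIntegral_Ioi_stdNormalPDF, ← integral_const_mul]
  -- For `u > t` the factor `t` is at most `u`, and `u φ(u) = -φ'(u)` integrates to `φ(t)`.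
  have : ∫ u in Set.Ioi t, t * gaussianPDFReal 0 1 u
      ≤ ∫ u in Set.Ioi t, -(-u * gaussianPDFReal 0 1 u) := by
    refine setIntegral_mono_on (hi.const_mul _).integrableOn hint.neg measurableSet_Ioi
      fun u hu => ?_
    have := gaussianPDFReal_nonneg 0 1 u
    have hu' : t < u := hu
    nlinarith
  rw [integral_neg, hval] at this
  linarith

/-! ### Stein's equation. -/

lemma integral_stdNormal (h : ℝ → ℝ) :
    ∫ x, h x ∂(gaussianReal 0 1) = ∫ x, h x * gaussianPDFReal 0 1 x := by
  rw [integral_gaussianReal_eq_integral_smul one_ne_zero]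
  simp [mul_comm]

/-- Bounded solution of the Stein equation `f' x - x f x = h x - ∫ h dN(0, 1)`. -/
lemma exists_stein_solution {h : ℝ → ℝ} (hc : Continuous h) (h0 : ∀ x, 0 ≤ h x)
    (h1 : ∀ x, h x ≤ 1) :
    ∃ f : ℝ → ℝ,
      (∀ x, HasDerivAt f (x * f x + (h x - ∫ t, h t ∂(gaussianReal 0 1))) x) ∧
      (∀ x, |f x| ≤ 2) ∧ ∀ x, |x * f x| ≤ 1 := by
  set m := ∫ t, h t ∂(gaussianReal 0 1) with hm
  set φ := gaussianPDFReal 0 1 with hφ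
  have hi : Integrable φ := integrable_gaussianPDFReal 0 1
  have hφc : Continuous φ := by
    rw [show φ = fun x => (√(2 * Real.pi))⁻¹ * Real.exp (-x ^ 2 / 2) from funext stdNormalPDF_eq]
    fun_prop
  have hφ0 : ∀ x, 0 < φ x := fun x => gaussianPDFReal_pos 0 1 x one_ne_zero
  have hhi : Integrable h (gaussianReal 0 1) :=
    Integrable.of_bound hc.aestronglyMeasurable 1
      (Filter.Eventually.of_forall fun x => by
        rw [Real.norm_eq_abs, abs_of_nonneg (h0 x)]; exact h1 x)
  have hm0 : 0 ≤ m := integral_nonneg h0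
  have hm1 : m ≤ 1 := by
    have := integral_mono hhi (integrable_const (1 : ℝ)) h1
    simpa using this
  have hb : ∀ x, |h x - m| ≤ 1 := fun x => by
    rw [abs_le]; constructor <;> linarith [h0 x, h1 x]
  set g : ℝ → ℝ := fun t => (h t - m) * φ t with hg
  have hgc : Continuous g := by fun_prop
  have hgb : ∀ t, ‖g t‖ ≤ φ t := fun t => by
    rw [hg, Real.norm_eq_abs, abs_mul, abs_of_pos (hφ0 t)]
    exact mul_le_of_le_one_left (hφ0 t).le (hb t)
  have hgi : Integrable g := hi.mono' hgc.aestronglyMeasurable (Filter.Eventually.of_forall hgb)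
  have hhφ : Integrable fun t => h t * φ t := by
    refine hi.mono' (by fun_prop) (Filter.Eventually.of_forall fun t => ?_)
    rw [Real.norm_eq_abs, abs_mul, abs_of_pos (hφ0 t), abs_of_nonneg (h0 t)]
    exact mul_le_of_le_one_left (hφ0 t).le (h1 t)
  -- Since `m` is the Gaussian mean of `h`, the primitive `G` can be computed from either end of the
  -- line, hence is dominated by the smaller Gaussian tail.
  have hg0 : ∫ t, g t = 0 := by
    simp only [hg, sub_mul]
    rw [integral_sub hhφ (hi.const_mul m), integral_const_mul, ← integral_stdNormal,
      integral_gaussianPDFReal_eq_one 0 one_ne_zero, ← hm]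
    ring
  set G : ℝ → ℝ := fun x => ∫ t in Set.Iic x, g t with hG
  have hGd : ∀ x, HasDerivAt G (g x) x := fun x => by
    have h2 : G = fun x => G 0 + ∫ t in (0 : ℝ)..x, g t := by
      funext y
      rw [← intervalIntegral.integral_Iic_sub_Iic hgi.integrableOn hgi.integrableOn]
      simp [hG]
    rw [h2]
    exact (intervalIntegral.integral_hasDerivAt_right hgi.intervalIntegrable
      (hgc.stronglyMeasurableAtFilter _ _) hgc.continuousAt).const_add _
  have hGl : ∀ x, |G x| ≤ stdNormalCDF x := fun x => by
    rw [stdNormalCDF_eq_setIntegral]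
    exact norm_integral_le_of_norm_le hi.integrableOn (Filter.Eventually.of_forall hgb)
  have hGr : ∀ x, |G x| ≤ stdNormalCDF (-x) := fun x => by
    have h3 : G x = - ∫ t in Set.Ioi x, g t := by
      have := intervalIntegral.integral_Iic_add_Ioi (b := x) hgi.integrableOn hgi.integrableOn
      rw [hg0] at this
      linarith
    rw [stdNormalCDF_neg, ← setIntegral_Ioi_stdNormalPDF, h3, abs_neg]
    exact norm_integral_le_of_norm_le hi.integrableOn (Filter.Eventually.of_forall hgb)
  have hGa : ∀ x, |G x| ≤ stdNormalCDF (-|x|) := fun x => by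
    rcases abs_cases x with ⟨hx, _⟩ | ⟨hx, _⟩
    · rw [hx]; exact hGr x
    · rw [hx, neg_neg]; exact hGl x
  have hφabs : ∀ x, φ |x| = φ x := fun x => by
    rw [hφ, stdNormalPDF_eq, stdNormalPDF_eq, sq_abs]
  refine ⟨fun x => G x / φ x, fun x => ?_, fun x => ?_, fun x => ?_⟩
  · refine ((hGd x).div (hasDerivAt_stdNormalPDF x) (hφ0 x).ne').congr_deriv ?_
    have := (hφ0 x).ne'
    rw [← hφ]
    simp only [hg]
    field_simp
    ring
  · rw [abs_div, abs_of_pos (hφ0 x), div_le_iff₀ (hφ0 x)]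
    refine (hGa x).trans ((stdNormalCDF_neg_le (abs_nonneg x)).trans ?_)
    rw [← hφabs, hφ, stdNormalPDF_eq]
    -- The tail bound gives `|G| / φ ≤ √(2π) / 2`, which is below 2.
    have h4 : 1 / 2 ≤ 2 * (√(2 * Real.pi))⁻¹ := by
      have : √(2 * Real.pi) ≤ 4 := by
        rw [Real.sqrt_le_left (by norm_num)]
        nlinarith [Real.pi_le_four]
      have hp : 0 < √(2 * Real.pi) := by positivity
      rw [← div_eq_mul_inv, le_div_iff₀ hp]
      linarith
    nlinarith [Real.exp_pos (-|x| ^ 2 / 2)]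
  · rw [abs_mul, abs_div, abs_of_pos (hφ0 x), ← mul_div_assoc, div_le_iff₀ (hφ0 x), one_mul]
    calc |x| * |G x| ≤ |x| * stdNormalCDF (-|x|) := by gcongr; exact hGa x
      _ ≤ φ |x| := mul_stdNormalCDF_neg_le (abs_nonneg x)
      _ = φ x := hφabs x

/-! ### Ramp functions and the regularity of their Stein solutions. -/

/-- The continuous function equal to `1` before `z`, to `0` after `z + l`, and affine between. -/
noncomputable def ramp (z l x : ℝ) : ℝ := max 0 (min 1 ((z + l - x) / l))

lemma continuous_ramp (z l : ℝ) : Continuous (ramp z l) := by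
  unfold ramp; fun_prop

lemma ramp_nonneg (z l x : ℝ) : 0 ≤ ramp z l x := le_max_left _ _

lemma ramp_le_one (z l x : ℝ) : ramp z l x ≤ 1 := max_le zero_le_one (min_le_left _ _)

lemma ramp_eq_one {z l x : ℝ} (hl : 0 < l) (hx : x ≤ z) : ramp z l x = 1 := by
  have : 1 ≤ (z + l - x) / l := by rw [le_div_iff₀ hl]; linarith
  rw [ramp, min_eq_left this, max_eq_right zero_le_one]

lemma ramp_eq_zero {z l x : ℝ} (hl : 0 < l) (hx : z + l ≤ x) : ramp z l x = 0 := by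
  have : (z + l - x) / l ≤ 0 := div_nonpos_of_nonpos_of_nonneg (by linarith) hl.le
  rw [ramp, max_eq_left ((min_le_right _ _).trans this)]

lemma abs_ramp_sub_le (z : ℝ) {l : ℝ} (hl : 0 < l) (x y : ℝ) :
    |ramp z l y - ramp z l x| ≤ |y - x| / l := by
  unfold ramp
  calc |max 0 (min 1 ((z + l - y) / l)) - max 0 (min 1 ((z + l - x) / l))|
      ≤ |min 1 ((z + l - y) / l) - min 1 ((z + l - x) / l)| := by
        have := abs_max_sub_max_le_max 0 (min 1 ((z + l - y) / l)) 0 (min 1 ((z + l - x) / l))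
        simpa using this
    _ ≤ |(z + l - y) / l - (z + l - x) / l| := by
        have := abs_min_sub_min_le_max 1 ((z + l - y) / l) 1 ((z + l - x) / l)
        simpa using this
    _ = |y - x| / l := by
        rw [← sub_div, abs_div, abs_of_pos hl, ← abs_neg]
        ring_nf

/-- A bound for the increments of `ramp z l` at `x` of step at most `r`. -/
noncomputable def rampIncr (z l x r : ℝ) : ℝ :=
  if z - r < x ∧ x ≤ z + l + r then min 1 (r / l) else 0

/-- Outside the window both points lie on the same flat piece. Keeping this localization, rather
than the plain Lipschitz bound `r / l`, lets the concentration of `x` be used later. -/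
lemma abs_ramp_add_sub_le (z : ℝ) {l : ℝ} (hl : 0 < l) {x y r : ℝ} (hy : |y| ≤ r) :
    |ramp z l (x + y) - ramp z l x| ≤ rampIncr z l x r := by
  obtain ⟨h1, h2⟩ := abs_le.1 hy
  unfold rampIncr
  split_ifs with h
  · refine le_min ?_ ?_
    · rw [abs_le]
      constructor <;> linarith [ramp_nonneg z l (x + y), ramp_le_one z l (x + y),
        ramp_nonneg z l x, ramp_le_one z l x]
    · refine (abs_ramp_sub_le z hl x (x + y)).trans ?_
      rw [add_sub_cancel_left]
      gcongr
  · rcases not_and_or.1 h with h | h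
    · rw [ramp_eq_one hl (by linarith), ramp_eq_one hl (by linarith [abs_nonneg y])]
      simp
    · rw [ramp_eq_zero hl (by linarith), ramp_eq_zero hl (by linarith [abs_nonneg y])]
      simp

/-- A bound for the increments at `x` of step at most `r` of the derivative of the Stein solution
of `ramp z l`. -/
noncomputable def steinIncr (z l x r : ℝ) : ℝ := r * (2 + 2 * |x|) + rampIncr z l x r

lemma rampIncr_nonneg (z : ℝ) {l x r : ℝ} (hl : 0 < l) (hr : 0 ≤ r) : 0 ≤ rampIncr z l x r := by
  unfold rampIncr
  split_ifs <;> positivity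

lemma rampIncr_le (z : ℝ) {l x r : ℝ} (hl : 0 < l) (hr : 0 ≤ r) : rampIncr z l x r ≤ r / l := by
  unfold rampIncr
  split_ifs
  · exact min_le_right _ _
  · positivity

/-- Here `g = f'`. Its increment is `y f(x + y) + x (f(x + y) - f(x))` plus that of the ramp, and
`f` is bounded by 2 and 2-Lipschitz. -/
lemma exists_ramp_stein_solution (z : ℝ) {l : ℝ} (hl : 0 < l) :
    ∃ f g : ℝ → ℝ, Continuous f ∧ Continuous g ∧ (∀ x, |f x| ≤ 2) ∧ (∀ x, |g x| ≤ 2) ∧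
      (∀ x, g x = x * f x + (ramp z l x - ∫ t, ramp z l t ∂(gaussianReal 0 1))) ∧
      (∀ x y, |g (x + y) - g x| ≤ steinIncr z l x |y|) ∧
      ∀ x y, |f (x + y) - f x - y * g x| ≤ |y| * steinIncr z l x |y| := by
  obtain ⟨f, hf, hf2, hf1⟩ := exists_stein_solution (continuous_ramp z l) (ramp_nonneg z l)
    (ramp_le_one z l)
  set m := ∫ t, ramp z l t ∂(gaussianReal 0 1) with hm
  have hfc : Continuous f := continuous_iff_continuousAt.2 fun x => (hf x).continuousAt
  have hri : Integrable (ramp z l) (gaussianReal 0 1) :=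
    Integrable.of_bound (continuous_ramp z l).aestronglyMeasurable 1
      (Filter.Eventually.of_forall fun x => by
        rw [Real.norm_eq_abs, abs_of_nonneg (ramp_nonneg z l x)]; exact ramp_le_one z l x)
  have hm0 : 0 ≤ m := integral_nonneg (ramp_nonneg z l)
  have hm1 : m ≤ 1 := by
    have := integral_mono hri (integrable_const (1 : ℝ)) (ramp_le_one z l)
    simpa using this
  have hg2 : ∀ x, |x * f x + (ramp z l x - m)| ≤ 2 := fun x => by
    have h1 := abs_le.1 (hf1 x)
    have h2 := ramp_nonneg z l x
    have h3 := ramp_le_one z l x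
    rw [abs_le]
    constructor <;> linarith
  have hlip : ∀ x y, |f (x + y) - f x| ≤ 2 * |y| := fun x y => by
    have := convex_univ.norm_image_sub_le_of_norm_hasDerivWithin_le (f := f) (C := 2)
      (fun x _ => (hf x).hasDerivWithinAt) (fun x _ => hg2 x) (Set.mem_univ x)
      (Set.mem_univ (x + y))
    simpa using this
  have hincr : ∀ x y r, |y| ≤ r → |(x + y) * f (x + y) + (ramp z l (x + y) - m)
      - (x * f x + (ramp z l x - m))| ≤ steinIncr z l x r := fun x y r hy => by
    have e : (x + y) * f (x + y) + (ramp z l (x + y) - m) - (x * f x + (ramp z l x - m))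
        = y * f (x + y) + x * (f (x + y) - f x) + (ramp z l (x + y) - ramp z l x) := by ring
    rw [e]
    refine (abs_add_three _ _ _).trans ?_
    rw [abs_mul, abs_mul]
    have h1 : |y| * |f (x + y)| ≤ r * 2 :=
      mul_le_mul hy (hf2 _) (abs_nonneg _) ((abs_nonneg y).trans hy)
    have h2 : |x| * |f (x + y) - f x| ≤ |x| * (2 * r) :=
      mul_le_mul_of_nonneg_left ((hlip x y).trans (by linarith)) (abs_nonneg _)
    have h3 := abs_ramp_add_sub_le z hl (x := x) hy
    unfold steinIncr
    linarith
  refine ⟨f, fun x => x * f x + (ramp z l x - m), hfc, ?_, hf2, hg2, fun _ => rfl,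
    fun x y => hincr x y _ le_rfl, fun x y => ?_⟩
  · have := continuous_ramp z l
    fun_prop
  -- Mean value inequality for `t ↦ f(x + t) - t g(x)`, whose derivative `g(x + t) - g(x)` is
  -- bounded uniformly for `|t| ≤ |y|`.
  · have hd : ∀ t ∈ Set.Icc (-|y|) |y|, HasDerivWithinAt
        (fun t => f (x + t) - t * (x * f x + (ramp z l x - m)))
        ((x + t) * f (x + t) + (ramp z l (x + t) - m) - (x * f x + (ramp z l x - m)))
        (Set.Icc (-|y|) |y|) t := fun t _ => by
      have h1 := (hf (x + t)).comp_const_add x t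
      have h2 := (hasDerivAt_id t).mul_const (x * f x + (ramp z l x - m))
      rw [one_mul] at h2
      exact (h1.sub h2).hasDerivWithinAt
    have := (convex_Icc (-|y|) |y|).norm_image_sub_le_of_norm_hasDerivWithin_le
      (C := steinIncr z l x |y|) hd (fun t ht => hincr x t _ (abs_le.2 ht))
      (x := 0) (y := y) (by simp) ⟨neg_abs_le y, le_abs_self y⟩
    simp only [Real.norm_eq_abs, add_zero, zero_mul, sub_zero] at this
    rw [mul_comm |y|]
    convert this using 2
    ring

lemma measurable_rampIncr (z l : ℝ) : Measurable fun p : ℝ × ℝ => rampIncr z l p.1 |p.2| := by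
  unfold rampIncr
  refine Measurable.ite ?_ (by fun_prop) measurable_const
  have h1 : MeasurableSet {p : ℝ × ℝ | z - |p.2| < p.1} :=
    measurableSet_lt (by fun_prop) (by fun_prop)
  have h2 : MeasurableSet {p : ℝ × ℝ | p.1 ≤ z + l + |p.2|} :=
    measurableSet_le (by fun_prop) (by fun_prop)
  exact h1.inter h2

/-! ### Stein expansion when one independent summand is added. -/

section StepBound

variable {μ ν : Measure ℝ} [IsProbabilityMeasure μ]

/-- The smooth part contributes `4r`. The window has length `l + 2r`, hence mass at most `l + 2r +
δ`; multiplied by `min 1 (r / l)` this is at most `r + 2r + r δ / l`. -/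
lemma integral_steinIncr_le (hx : Integrable (fun x => x) μ) (hx1 : ∫ x, |x| ∂μ ≤ 1) {δ : ℝ}
    (hδ : 0 ≤ δ) (hμ : ∀ a b, a ≤ b → μ.real (Set.Ioc a b) ≤ (b - a) + δ)
    (z : ℝ) {l r : ℝ} (hl : 0 < l) (hr : 0 ≤ r) :
    ∫ x, steinIncr z l x r ∂μ ≤ r * (7 + δ / l) := by
  have e : (fun x => rampIncr z l x r)
      = (Set.Ioc (z - r) (z + l + r)).indicator fun _ => min 1 (r / l) := by
    funext x
    simp [rampIncr, Set.indicator_apply]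
  have hi1 : Integrable (fun x => r * (2 + 2 * |x|)) μ :=
    ((integrable_const _).add (hx.abs.const_mul 2)).const_mul r
  have hi2 : Integrable (fun x => rampIncr z l x r) μ := by
    rw [e]; exact (integrable_const _).indicator measurableSet_Ioc
  unfold steinIncr
  rw [integral_add hi1 hi2, integral_const_mul, integral_add (integrable_const _)
    (hx.abs.const_mul 2), integral_const_mul, e, integral_indicator_const _ measurableSet_Ioc]
  have h1 := hμ (z - r) (z + l + r) (by linarith)
  have h2 : min 1 (r / l) * l ≤ r :=
    (mul_le_mul_of_nonneg_right (min_le_right _ _) hl.le).trans_eq (by field_simp)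
  have h3 : min 1 (r / l) * (2 * r) ≤ 2 * r :=
    mul_le_of_le_one_left (by positivity) (min_le_left _ _)
  have h4 : min 1 (r / l) * δ ≤ r * (δ / l) :=
    (mul_le_mul_of_nonneg_right (min_le_right _ _) hδ).trans_eq (by field_simp)
  have h5 : μ.real (Set.Ioc (z - r) (z + l + r)) * min 1 (r / l)
      ≤ ((z + l + r - (z - r)) + δ) * min 1 (r / l) :=
    mul_le_mul_of_nonneg_right h1 (by positivity)
  have h6 : r * ∫ x, |x| ∂μ ≤ r * 1 := mul_le_mul_of_nonneg_left hx1 hr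
  simp only [integral_const, probReal_univ, smul_eq_mul, one_mul]
  nlinarith

lemma integrable_mul_steinIncr [SFinite ν] (hx : Integrable (fun x => x) μ) {w : ℝ → ℝ}
    (hwm : Measurable w) (hw : Integrable (fun y => w y * |y|) ν) (z : ℝ) {l : ℝ} (hl : 0 < l) :
    Integrable (fun p : ℝ × ℝ => w p.2 * steinIncr z l p.1 |p.2|) (μ.prod ν) := by
  have hd : Integrable (fun p : ℝ × ℝ => (2 + 2 * |p.1| + 1 / l) * (w p.2 * |p.2|)) (μ.prod ν) :=
    Integrable.mul_prod (((integrable_const _).add (hx.abs.const_mul 2)).add (integrable_const _))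
      hw
  refine hd.mono ?_ (Filter.Eventually.of_forall fun p => ?_)
  · have := measurable_rampIncr z l
    unfold steinIncr
    exact Measurable.aestronglyMeasurable (by fun_prop)
  · have h0 := rampIncr_nonneg z (x := p.1) hl (abs_nonneg p.2)
    have h1 := rampIncr_le z (x := p.1) hl (abs_nonneg p.2)
    simp only [norm_mul, Real.norm_eq_abs, abs_abs]
    unfold steinIncr
    rw [abs_of_nonneg (by positivity : 0 ≤ |p.2| * (2 + 2 * |p.1|) + rampIncr z l p.1 |p.2|),
      abs_of_nonneg (by positivity : 0 ≤ 2 + 2 * |p.1| + 1 / l), mul_left_comm]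
    gcongr
    rw [div_eq_mul_one_div] at h1
    linarith

lemma integral_mul_steinIncr_le [SFinite ν] (hx : Integrable (fun x => x) μ)
    (hx1 : ∫ x, |x| ∂μ ≤ 1) {δ : ℝ}
    (hδ : 0 ≤ δ) (hμ : ∀ a b, a ≤ b → μ.real (Set.Ioc a b) ≤ (b - a) + δ) {w : ℝ → ℝ}
    (hwm : Measurable w) (hw0 : ∀ y, 0 ≤ w y) (hw : Integrable (fun y => w y * |y|) ν)
    (z : ℝ) {l : ℝ} (hl : 0 < l) :
    ∫ p : ℝ × ℝ, w p.2 * steinIncr z l p.1 |p.2| ∂(μ.prod ν)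
      ≤ (∫ y, w y * |y| ∂ν) * (7 + δ / l) := by
  have hi := integrable_mul_steinIncr (μ := μ) hx hwm hw z hl
  rw [integral_prod_symm _ hi, ← integral_mul_const]
  refine integral_mono hi.integral_prod_right (hw.mul_const _) fun y => ?_
  simp only [integral_const_mul]
  rw [mul_assoc]
  exact mul_le_mul_of_nonneg_left
    (integral_steinIncr_le hx hx1 hδ hμ z hl (abs_nonneg y)) (hw0 y)

lemma integrable_of_integrable_abs_pow_three {ν : Measure ℝ} [IsFiniteMeasure ν] {k : ℕ}
    (hk : k ≤ 3)
    (h3 : Integrable (fun y => |y| ^ 3) ν) : Integrable (fun y => |y| ^ k) ν := by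
  refine ((integrable_const 1).add h3).mono' (by fun_prop)
    (Filter.Eventually.of_forall fun y => ?_)
  rw [Real.norm_eq_abs, abs_of_nonneg (by positivity)]
  rcases le_total |y| 1 with h | h
  · have : |y| ^ k ≤ 1 := pow_le_one₀ (abs_nonneg y) h
    have : 0 ≤ |y| ^ 3 := by positivity
    simp only [Pi.add_apply]
    linarith
  · have : |y| ^ k ≤ |y| ^ 3 := pow_le_pow_right₀ h hk
    simp only [Pi.add_apply]
    linarith

/-- Expand `f(x + y) = f(x) + y g(x) + R`. After multiplication by `y`, independence and centering
kill the first term, and the second gives `E y² · E g(x)`. The remainder, and the replacement of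
`g(x)` by `g(x + y)`, each cost `E|y|³ (7 + δ / l)`. -/
lemma abs_integral_stein_sub_le [IsProbabilityMeasure ν] (hx : Integrable (fun x => x) μ)
    (hx1 : ∫ x, |x| ∂μ ≤ 1) {δ : ℝ}
    (hδ : 0 ≤ δ) (hμ : ∀ a b, a ≤ b → μ.real (Set.Ioc a b) ≤ (b - a) + δ)
    (h3 : Integrable (fun y => |y| ^ 3) ν) (hy0 : ∫ y, y ∂ν = 0)
    (hy1 : (∫ y, y ^ 2 ∂ν) * ∫ y, |y| ∂ν ≤ ∫ y, |y| ^ 3 ∂ν)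
    (z : ℝ) {l : ℝ} (hl : 0 < l) {f g : ℝ → ℝ} (hf : Continuous f) (hg : Continuous g)
    (hf2 : ∀ x, |f x| ≤ 2) (hg2 : ∀ x, |g x| ≤ 2)
    (hgi : ∀ x y, |g (x + y) - g x| ≤ steinIncr z l x |y|)
    (hfi : ∀ x y, |f (x + y) - f x - y * g x| ≤ |y| * steinIncr z l x |y|) :
    |(∫ p : ℝ × ℝ, p.2 * f (p.1 + p.2) ∂(μ.prod ν))
        - (∫ y, y ^ 2 ∂ν) * ∫ p : ℝ × ℝ, g (p.1 + p.2) ∂(μ.prod ν)|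
      ≤ 2 * (∫ y, |y| ^ 3 ∂ν) * (7 + δ / l) := by
  set v := ∫ y, y ^ 2 ∂ν with hv
  have hv0 : 0 ≤ v := integral_nonneg fun y => sq_nonneg y
  have i1 : Integrable (fun y : ℝ => |y|) ν := by
    simpa using integrable_of_integrable_abs_pow_three (k := 1) (by norm_num) h3
  have i1' : Integrable (fun y : ℝ => y) ν := (integrable_norm_iff (by fun_prop)).1 i1
  have i2 : Integrable (fun y : ℝ => y ^ 2) ν := by
    simpa using integrable_of_integrable_abs_pow_three (k := 2) (by norm_num) h3
  have i3 : Integrable (fun y : ℝ => y ^ 2 * |y|) ν := by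
    refine h3.congr (Filter.Eventually.of_forall fun y => ?_)
    simp only
    rw [← sq_abs y]; ring
  have e3 : ∫ y, y ^ 2 * |y| ∂ν = ∫ y, |y| ^ 3 ∂ν :=
    integral_congr_ae (Filter.Eventually.of_forall fun y => by
      simp only
      rw [← sq_abs y]; ring)
  have ifm : Integrable f μ := Integrable.of_bound hf.aestronglyMeasurable 2
    (Filter.Eventually.of_forall hf2)
  have igm : Integrable g μ := Integrable.of_bound hg.aestronglyMeasurable 2
    (Filter.Eventually.of_forall hg2)
  have igp : Integrable (fun p : ℝ × ℝ => g (p.1 + p.2)) (μ.prod ν) :=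
    Integrable.of_bound (by fun_prop) 2 (Filter.Eventually.of_forall fun p => hg2 _)
  have ig1 : Integrable (fun p : ℝ × ℝ => g p.1) (μ.prod ν) :=
    Integrable.of_bound (by fun_prop) 2 (Filter.Eventually.of_forall fun p => hg2 _)
  have iA : Integrable (fun p : ℝ × ℝ => f p.1 * p.2) (μ.prod ν) := ifm.mul_prod i1'
  have iB : Integrable (fun p : ℝ × ℝ => g p.1 * p.2 ^ 2) (μ.prod ν) := igm.mul_prod i2
  have iM := integrable_mul_steinIncr (μ := μ) (ν := ν) (w := fun y => y ^ 2) hx (by fun_prop)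
    i3 z hl
  have hR : ∀ p : ℝ × ℝ, ‖p.2 * (f (p.1 + p.2) - f p.1 - p.2 * g p.1)‖
      ≤ p.2 ^ 2 * steinIncr z l p.1 |p.2| := fun p => by
    rw [norm_mul, Real.norm_eq_abs, Real.norm_eq_abs, ← sq_abs p.2, pow_two, mul_assoc]
    exact mul_le_mul_of_nonneg_left (hfi _ _) (abs_nonneg _)
  have iR : Integrable (fun p : ℝ × ℝ => p.2 * (f (p.1 + p.2) - f p.1 - p.2 * g p.1))
      (μ.prod ν) :=
    iM.mono' (by fun_prop) (Filter.Eventually.of_forall hR)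
  have b1 := (norm_integral_le_of_norm_le iM (Filter.Eventually.of_forall hR)).trans
    (integral_mul_steinIncr_le (w := fun y => y ^ 2) hx hx1 hδ hμ (by fun_prop)
      (fun y => sq_nonneg y) i3 z hl)
  have iN := integrable_mul_steinIncr (μ := μ) (ν := ν) (w := fun _ => 1) hx (by fun_prop)
    (by simpa using i1) z hl
  have b2 := (norm_integral_le_of_norm_le (f := fun p : ℝ × ℝ => g (p.1 + p.2) - g p.1)
    iN (Filter.Eventually.of_forall fun p : ℝ × ℝ => by
      rw [one_mul]; exact hgi p.1 p.2)).trans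
    (integral_mul_steinIncr_le (w := fun _ => 1) hx hx1 hδ hμ (by fun_prop)
      (fun y => zero_le_one) (by simpa using i1) z hl)
  have e1 : ∫ p : ℝ × ℝ, p.2 * f (p.1 + p.2) ∂(μ.prod ν)
      = (∫ p : ℝ × ℝ, p.2 * (f (p.1 + p.2) - f p.1 - p.2 * g p.1) ∂(μ.prod ν))
        + v * ∫ x, g x ∂μ := by
    have h1 : ∫ p : ℝ × ℝ, f p.1 * p.2 ∂(μ.prod ν) = 0 := by
      rw [integral_prod_mul f (fun y => y), hy0, mul_zero]
    have h2 : ∫ p : ℝ × ℝ, g p.1 * p.2 ^ 2 ∂(μ.prod ν) = v * ∫ x, g x ∂μ := by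
      rw [integral_prod_mul g (fun y => y ^ 2), mul_comm]
    have h3 : ∫ p : ℝ × ℝ, p.2 * f (p.1 + p.2) ∂(μ.prod ν)
        = ∫ p : ℝ × ℝ, (p.2 * (f (p.1 + p.2) - f p.1 - p.2 * g p.1)
          + (g p.1 * p.2 ^ 2 + f p.1 * p.2)) ∂(μ.prod ν) :=
      integral_congr_ae (Filter.Eventually.of_forall fun p => by ring)
    have iC : Integrable (fun p : ℝ × ℝ => g p.1 * p.2 ^ 2 + f p.1 * p.2) (μ.prod ν) := iB.add iA
    rw [h3, integral_add iR iC, integral_add iB iA, h1, h2, add_zero]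
  have e2 : ∫ p : ℝ × ℝ, g (p.1 + p.2) ∂(μ.prod ν)
      = (∫ p : ℝ × ℝ, (g (p.1 + p.2) - g p.1) ∂(μ.prod ν)) + ∫ x, g x ∂μ := by
    rw [integral_sub igp ig1, integral_fun_fst]
    simp
  rw [e1, e2]
  rw [e3] at b1
  simp only [one_mul, Real.norm_eq_abs] at b1 b2
  have b3 := mul_le_mul_of_nonneg_left b2 hv0
  have hc : 0 ≤ 7 + δ / l := by positivity
  have b4 := mul_le_mul_of_nonneg_right hy1 hc
  rw [show ∀ a b c d : ℝ, a + v * c - v * (d + c) = a - v * d by intros; ring]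
  · refine (abs_sub _ _).trans ?_
    rw [abs_mul, abs_of_nonneg hv0]
    nlinarith
  -- The variable `b` is absent from the identity just used, so any real serves for it.
  · exact 0

end StepBound

/-! ### Stein's method for sums, and smoothing. -/

lemma abs_integral_ramp_sum_sub_le {Ω ι : Type*} [MeasurableSpace Ω] [DecidableEq ι]
    {P : Measure Ω} [IsProbabilityMeasure P] {Z : ι → Ω → ℝ} (hZ : ∀ i, Measurable (Z i))
    (hind : iIndepFun Z P) (s : Finset ι) (h3 : ∀ i ∈ s, Integrable (fun ω => |Z i ω| ^ 3) P)
    (h0 : ∀ i ∈ s, ∫ ω, Z i ω ∂P = 0)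
    (h1 : ∀ i ∈ s, (∫ ω, Z i ω ^ 2 ∂P) * ∫ ω, |Z i ω| ∂P ≤ ∫ ω, |Z i ω| ^ 3 ∂P)
    (h2 : ∑ i ∈ s, ∫ ω, Z i ω ^ 2 ∂P = 1)
    (hW : ∀ i ∈ s, ∫ ω, |∑ j ∈ s.erase i, Z j ω| ∂P ≤ 1) {δ : ℝ} (hδ : 0 ≤ δ)
    (hWδ : ∀ i ∈ s, ∀ a b, a ≤ b →
      P.real {ω | ∑ j ∈ s.erase i, Z j ω ∈ Set.Ioc a b} ≤ (b - a) + δ)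
    (z : ℝ) {l : ℝ} (hl : 0 < l) :
    |(∫ ω, ramp z l (∑ i ∈ s, Z i ω) ∂P) - ∫ t, ramp z l t ∂(gaussianReal 0 1)|
      ≤ 2 * (∑ i ∈ s, ∫ ω, |Z i ω| ^ 3 ∂P) * (7 + δ / l) := by
  obtain ⟨f, g, hf, hg, hf2, hg2, hgeq, hgi, hfi⟩ := exists_ramp_stein_solution z hl
  have hSm : ∀ t : Finset ι, Measurable fun ω => ∑ i ∈ t, Z i ω := fun t =>
    Finset.measurable_fun_sum _ fun i _ => hZ i
  have hint : ∀ i ∈ s, Integrable (Z i) P := fun i hi => by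
    have hm : Integrable (fun y : ℝ => |y| ^ 3) (P.map (Z i)) :=
      (integrable_map_measure (by fun_prop) (hZ i).aemeasurable).2 (h3 i hi)
    have : IsProbabilityMeasure (P.map (Z i)) := Measure.isProbabilityMeasure_map (hZ i).aemeasurable
    have := integrable_of_integrable_abs_pow_three (k := 1) (by norm_num) hm
    have := (integrable_map_measure (by fun_prop) (hZ i).aemeasurable).1 this
    refine (integrable_norm_iff (hZ i).aestronglyMeasurable).1 ?_
    simpa [Function.comp_def] using this
  have hZf : ∀ i ∈ s, Integrable (fun ω => Z i ω * f (∑ j ∈ s, Z j ω)) P := fun i hi =>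
    (hint i hi).mul_bdd (c := 2) (hf.measurable.comp (hSm s)).aestronglyMeasurable
      (Filter.Eventually.of_forall fun ω => hf2 _)
  have hgS : Integrable (fun ω => g (∑ j ∈ s, Z j ω)) P :=
    Integrable.of_bound (hg.measurable.comp (hSm s)).aestronglyMeasurable 2
      (Filter.Eventually.of_forall fun ω => hg2 _)
  have hkey : ∀ i ∈ s, |(∫ ω, Z i ω * f (∑ j ∈ s, Z j ω) ∂P)
      - (∫ ω, Z i ω ^ 2 ∂P) * ∫ ω, g (∑ j ∈ s, Z j ω) ∂P|
        ≤ 2 * (∫ ω, |Z i ω| ^ 3 ∂P) * (7 + δ / l) := fun i hi => by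
    have hi1 : IsProbabilityMeasure (P.map (Z i)) :=
      Measure.isProbabilityMeasure_map (hZ i).aemeasurable
    have hi2 : IsProbabilityMeasure (P.map fun ω => ∑ j ∈ s.erase i, Z j ω) :=
      Measure.isProbabilityMeasure_map (hSm _).aemeasurable
    have hsum : ∀ ω, ∑ j ∈ s, Z j ω = (∑ j ∈ s.erase i, Z j ω) + Z i ω := fun ω =>
      (Finset.sum_erase_add s _ hi).symm
    have hprod : P.map (fun ω => (∑ j ∈ s.erase i, Z j ω, Z i ω))
        = (P.map fun ω => ∑ j ∈ s.erase i, Z j ω).prod (P.map (Z i)) := by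
      refine (indepFun_iff_map_prod_eq_prod_map_map (hSm _).aemeasurable (hZ i).aemeasurable).1 ?_
      have := hind.indepFun_finsetSum_of_notMem hZ (Finset.notMem_erase i s)
      convert this using 1
      funext ω
      simp
    have hpm : Measurable fun ω => (∑ j ∈ s.erase i, Z j ω, Z i ω) := (hSm _).prodMk (hZ i)
    have hi3 : Integrable (fun x => x) (P.map fun ω => ∑ j ∈ s.erase i, Z j ω) :=
      (integrable_map_measure (by fun_prop) (hSm _).aemeasurable).2
        (integrable_finsetSum _ fun j hj => hint j (Finset.mem_of_mem_erase hj))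
    have := abs_integral_stein_sub_le (μ := P.map fun ω => ∑ j ∈ s.erase i, Z j ω)
      (ν := P.map (Z i)) hi3
      (by rw [integral_map (hSm _).aemeasurable (by fun_prop)]; exact hW i hi) hδ
      (fun a b hab => by
        rw [map_measureReal_apply (hSm _) measurableSet_Ioc]; exact hWδ i hi a b hab)
      ((integrable_map_measure (by fun_prop) (hZ i).aemeasurable).2 (h3 i hi))
      (by rw [integral_map (hZ i).aemeasurable (by fun_prop)]; exact h0 i hi)
      (by
        rw [integral_map (hZ i).aemeasurable (by fun_prop),
          integral_map (hZ i).aemeasurable (by fun_prop),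
          integral_map (hZ i).aemeasurable (by fun_prop)]
        exact h1 i hi)
      z hl hf hg hf2 hg2 hgi hfi
    rw [← hprod, integral_map hpm.aemeasurable (by fun_prop),
      integral_map hpm.aemeasurable (by fun_prop), integral_map (hZ i).aemeasurable (by fun_prop),
      integral_map (hZ i).aemeasurable (by fun_prop)] at this
    simpa only [hsum] using this
  -- Stein's equation at the sum `W`: the difference is `E g(W) - E W f(W)`, and unit total variance
  -- splits `E g(W)` among the summands.
  have hE : (∫ ω, ramp z l (∑ i ∈ s, Z i ω) ∂P) - ∫ t, ramp z l t ∂(gaussianReal 0 1)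
      = - ∑ i ∈ s, ((∫ ω, Z i ω * f (∑ j ∈ s, Z j ω) ∂P)
        - (∫ ω, Z i ω ^ 2 ∂P) * ∫ ω, g (∑ j ∈ s, Z j ω) ∂P) := by
    rw [Finset.sum_sub_distrib, ← Finset.sum_mul, h2, one_mul, ← integral_finsetSum _ hZf]
    have e : ∀ ω, ramp z l (∑ i ∈ s, Z i ω) = (g (∑ i ∈ s, Z i ω)
        - ∑ i ∈ s, Z i ω * f (∑ j ∈ s, Z j ω)) + ∫ t, ramp z l t ∂(gaussianReal 0 1) := fun ω => by
      rw [← Finset.sum_mul, hgeq]; ring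
    have hd : Integrable (fun ω => g (∑ i ∈ s, Z i ω) - ∑ i ∈ s, Z i ω * f (∑ j ∈ s, Z j ω)) P :=
      hgS.sub (integrable_finsetSum _ hZf)
    simp_rw [e]
    rw [integral_add hd (integrable_const _), integral_sub hgS (integrable_finsetSum _ hZf)]
    simp
  rw [hE, abs_neg, Finset.mul_sum, Finset.sum_mul]
  exact (Finset.abs_sum_le_sum_abs _ _).trans (Finset.sum_le_sum hkey)

lemma measureReal_le_integral_ramp {Ω : Type*} [MeasurableSpace Ω] {P : Measure Ω}
    [IsProbabilityMeasure P] {S : Ω → ℝ} (hS : Measurable S) (z : ℝ) {l : ℝ} (hl : 0 < l) :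
    P.real {ω | S ω ≤ z} ≤ ∫ ω, ramp z l (S ω) ∂P ∧
      ∫ ω, ramp z l (S ω) ∂P ≤ P.real {ω | S ω ≤ z + l} := by
  have hm : ∀ t, MeasurableSet {ω | S ω ≤ t} := fun t => measurableSet_le hS measurable_const
  have hi : ∀ t, Integrable ({ω | S ω ≤ t}.indicator fun _ => (1 : ℝ)) P := fun t =>
    (integrable_const 1).indicator (hm t)
  have hr : Integrable (fun ω => ramp z l (S ω)) P :=
    Integrable.of_bound ((continuous_ramp z l).measurable.comp hS).aestronglyMeasurable 1
      (Filter.Eventually.of_forall fun x => by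
        rw [Real.norm_eq_abs, abs_of_nonneg (ramp_nonneg z l _)]; exact ramp_le_one z l _)
  have hI : ∀ t, ∫ ω, ({ω | S ω ≤ t}.indicator fun _ => (1 : ℝ)) ω ∂P = P.real {ω | S ω ≤ t} :=
    fun t => by rw [integral_indicator_const _ (hm t), smul_eq_mul, mul_one]
  rw [← hI, ← hI]
  refine ⟨integral_mono (hi _) hr fun ω => ?_, integral_mono hr (hi _) fun ω => ?_⟩
  · simp only [Set.indicator_apply, Set.mem_ofPred_eq]
    split_ifs with h
    · rw [ramp_eq_one hl h]
    · exact ramp_nonneg _ _ _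
  · simp only [Set.indicator_apply, Set.mem_ofPred_eq]
    split_ifs with h
    · exact ramp_le_one _ _ _
    · rw [ramp_eq_zero hl (by linarith)]

lemma one_div_sqrt_two_pi_le : 1 / √(2 * Real.pi) ≤ 1 / 2 := by
  have h2 : 2 ≤ √(2 * Real.pi) := by
    apply Real.le_sqrt_of_sq_le
    nlinarith [Real.pi_gt_three]
  exact one_div_le_one_div_of_le two_pos h2

/-- Smoothing: bounds on the expectations of ramps give a bound on the distribution function. -/
lemma abs_measureReal_le_sub_stdNormalCDF_le {Ω : Type*} [MeasurableSpace Ω] {P : Measure Ω}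
    [IsProbabilityMeasure P] {S : Ω → ℝ} (hS : Measurable S) {l C : ℝ} (hl : 0 < l)
    (h : ∀ z, |(∫ ω, ramp z l (S ω) ∂P) - ∫ t, ramp z l t ∂(gaussianReal 0 1)| ≤ C) (z : ℝ) :
    |P.real {ω | S ω ≤ z} - stdNormalCDF z| ≤ l / 2 + C := by
  have hΦ : ∀ t, (gaussianReal 0 1).real {x | x ≤ t} = stdNormalCDF t := fun t => by
    rw [stdNormalCDF, cdf_eq_real]; rfl
  have hlip : ∀ t, stdNormalCDF (t + l) - stdNormalCDF t ≤ l / 2 := fun t => by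
    refine (stdNormalCDF_sub_le (by linarith)).trans ?_
    rw [add_sub_cancel_left, div_eq_mul_one_div l, div_eq_mul_one_div l]
    exact mul_le_mul_of_nonneg_left one_div_sqrt_two_pi_le hl.le
  -- The indicator of `(-∞, z]` lies between the ramps starting at `z - l` and at `z`.
  have a1 := measureReal_le_integral_ramp (P := P) hS z hl
  have a2 := measureReal_le_integral_ramp (P := P) hS (z - l) hl
  have b1 := measureReal_le_integral_ramp (P := gaussianReal 0 1) measurable_id z hl
  have b2 := measureReal_le_integral_ramp (P := gaussianReal 0 1) measurable_id (z - l) hl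
  simp only [id, hΦ, sub_add_cancel] at a1 a2 b1 b2
  have c1 := abs_le.1 (h z)
  have c2 := abs_le.1 (h (z - l))
  have d1 := hlip z
  have d2 := hlip (z - l)
  rw [sub_add_cancel] at d2
  rw [abs_le]
  constructor <;> linarith

/-- Turns the induction hypothesis into the concentration bound required by the Stein step. -/
lemma measureReal_mem_Ioc_le {Ω : Type*} [MeasurableSpace Ω] {P : Measure Ω}
    [IsProbabilityMeasure P] {S : Ω → ℝ} (hS : Measurable S) {Δ : ℝ}
    (h : ∀ z, |P.real {ω | S ω ≤ z} - stdNormalCDF z| ≤ Δ) {a b : ℝ} (hab : a ≤ b) :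
    P.real {ω | S ω ∈ Set.Ioc a b} ≤ (b - a) / 2 + 2 * Δ := by
  have e : {ω | S ω ∈ Set.Ioc a b} = {ω | S ω ≤ b} \ {ω | S ω ≤ a} := by
    ext ω; simp [and_comm]
  have hsub : {ω | S ω ≤ a} ⊆ {ω | S ω ≤ b} := fun ω (hω : S ω ≤ a) => hω.trans hab
  rw [e, measureReal_sdiff hsub (measurableSet_le hS measurable_const)]
  have h1 := abs_le.1 (h a)
  have h2 := abs_le.1 (h b)
  have h3 := stdNormalCDF_sub_le hab
  rw [div_eq_mul_one_div] at h3
  have h4 := mul_le_mul_of_nonneg_left one_div_sqrt_two_pi_le (sub_nonneg.2 hab)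
  linarith

lemma abs_measureReal_sub_stdNormalCDF_le_one {Ω : Type*} [MeasurableSpace Ω] {P : Measure Ω}
    [IsProbabilityMeasure P] (A : Set Ω) (z : ℝ) : |P.real A - stdNormalCDF z| ≤ 1 := by
  have h1 : P.real A ≤ 1 := measureReal_le_one
  have h2 : 0 ≤ P.real A := measureReal_nonneg
  have h3 := stdNormalCDF_nonneg z
  have h4 := stdNormalCDF_le_one z
  rw [abs_le]
  constructor <;> linarith

/-! ### Berry-Esseen by induction on the number of summands. -/

section Standardized

variable {Ω ι : Type*} [MeasurableSpace Ω] {P : Measure Ω} [IsProbabilityMeasure P]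

lemma integral_abs_le_one {X : Ω → ℝ} (hX : MemLp X 2 P) (h : ∫ ω, X ω ^ 2 ∂P ≤ 1) :
    ∫ ω, |X ω| ∂P ≤ 1 := by
  have h1 : ∫ ω, |X ω| ∂P ≤ ∫ ω, (1 / 2 + X ω ^ 2 / 2) ∂P := by
    refine integral_mono (hX.integrable one_le_two).abs
      ((integrable_const _).add (hX.integrable_sq.div_const 2)) fun ω => ?_
    simp only
    nlinarith [sq_abs (X ω), sq_nonneg (|X ω| - 1)]
  rw [integral_add (integrable_const _) (hX.integrable_sq.div_const 2),
    integral_div 2 fun ω => X ω ^ 2] at h1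
  simp at h1
  linarith

/-- Integrate `x² ≤ 1/3 + (2/3)|x|³`. -/
lemma one_le_integral_abs_pow_three {X : Ω → ℝ} (hX : MemLp X 3 P)
    (h : ∫ ω, X ω ^ 2 ∂P = 1) : 1 ≤ ∫ ω, |X ω| ^ 3 ∂P := by
  have i2 := (hX.mono_exponent (p := 2) (by norm_num)).integrable_sq
  have i3 : Integrable (fun ω => |X ω| ^ 3) P := hX.integrable_norm_pow (p := 3) (by norm_num)
  have h1 : ∫ ω, X ω ^ 2 ∂P ≤ ∫ ω, (1 / 3 + |X ω| ^ 3 * (2 / 3)) ∂P := by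
    refine integral_mono i2 ((integrable_const _).add (i3.mul_const _)) fun ω => ?_
    simp only
    have := abs_nonneg (X ω)
    nlinarith [sq_abs (X ω), mul_nonneg this (sq_nonneg (|X ω| - 1)), sq_nonneg (|X ω| - 1)]
  rw [integral_add (integrable_const _) (i3.mul_const _), integral_mul_const, h] at h1
  simp at h1
  linarith

lemma integral_sq_sum {X : ι → Ω → ℝ} (hX : ∀ i, MemLp (X i) 2 P)
    (hind : iIndepFun X P) (h0 : ∀ i, ∫ ω, X i ω ∂P = 0) (s : Finset ι) :
    ∫ ω, (∑ i ∈ s, X i ω) ^ 2 ∂P = ∑ i ∈ s, ∫ ω, X i ω ^ 2 ∂P := by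
  have h := IndepFun.variance_sum (μ := P) (s := s) (X := X) (fun i _ => hX i)
    fun i _ j _ hij => hind.indepFun hij
  have h1 : Var[∑ i ∈ s, X i; P] = ∫ ω, (∑ i ∈ s, X i ω) ^ 2 ∂P := by
    rw [variance_of_integral_eq_zero]
    · simp
    · exact (Finset.aemeasurable_sum _ fun i _ => (hX i).aestronglyMeasurable.aemeasurable)
    · simp only [Finset.sum_apply]
      rw [integral_finsetSum _ fun i _ => (hX i).integrable one_le_two]
      exact Finset.sum_eq_zero fun i _ => h0 i
  rw [← h1, h]
  exact Finset.sum_congr rfl fun i _ =>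
    variance_of_integral_eq_zero (hX i).aestronglyMeasurable.aemeasurable (h0 i)

/-- The Berry-Esseen bound for standardized variables with a common third absolute moment. -/
lemma abs_measureReal_sum_le_sub_stdNormalCDF_le [DecidableEq ι] {X : ι → Ω → ℝ}
    (hm : ∀ i, Measurable (X i)) (hX : ∀ i, MemLp (X i) 3 P) (hind : iIndepFun X P)
    (h0 : ∀ i, ∫ ω, X i ω ∂P = 0) (h2 : ∀ i, ∫ ω, X i ω ^ 2 ∂P = 1) {γ : ℝ}
    (h3 : ∀ i, ∫ ω, |X i ω| ^ 3 ∂P = γ) (n : ℕ) :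
    ∀ (s : Finset ι), s.card = n + 1 → ∀ z,
      |P.real {ω | (∑ i ∈ s, X i ω) / √((n + 1 : ℕ) : ℝ) ≤ z} - stdNormalCDF z|
        ≤ 40 * γ / √((n + 1 : ℕ) : ℝ) := by
  induction n with
  | zero =>
    intro s hs z
    obtain ⟨i, -⟩ := Finset.card_pos.1 (by omega : 0 < s.card)
    have hγ : 1 ≤ γ := h3 i ▸ one_le_integral_abs_pow_three (hX i) (h2 i)
    refine (abs_measureReal_sub_stdNormalCDF_le_one _ z).trans ?_
    simp
    linarith
  | succ n ih =>
    intro s hs z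
    obtain ⟨i₀, -⟩ := Finset.card_pos.1 (by omega : 0 < s.card)
    have hγ : 1 ≤ γ := h3 i₀ ▸ one_le_integral_abs_pow_three (hX i₀) (h2 i₀)
    have hX2 : ∀ i, MemLp (X i) 2 P := fun i => (hX i).mono_exponent (by norm_num)
    set N : ℝ := ((n + 1 + 1 : ℕ) : ℝ) with hN
    set M : ℝ := ((n + 1 : ℕ) : ℝ) with hM
    have hM1 : 1 ≤ M := by rw [hM]; push_cast; linarith [Nat.cast_nonneg (α := ℝ) n]
    have hNM : N = M + 1 := by rw [hN, hM]; push_cast; ring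
    have hN0 : 0 < N := by linarith
    set q := √N with hq
    set r := √M with hr
    have hq0 : 0 < q := Real.sqrt_pos.2 hN0
    have hr0 : 0 < r := Real.sqrt_pos.2 (by linarith)
    have hqq : q ^ 2 = N := Real.sq_sqrt hN0.le
    have hrr : r ^ 2 = M := Real.sq_sqrt (by linarith)
    -- `N = M + 1 ≤ 2M` and `√2 ≤ 3/2`.
    have hqr : q ≤ 3 / 2 * r := by
      rw [← abs_of_pos hq0, ← abs_of_pos (by positivity : 0 < 3 / 2 * r), ← sq_le_sq]
      nlinarith
    set η := γ / q with hη
    have hη0 : 0 < η := by positivity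
    have hS : ∀ t : Finset ι, Measurable fun ω => ∑ i ∈ t, X i ω := fun t =>
      Finset.measurable_fun_sum _ fun i _ => hm i
    have habs1 : ∀ i, ∫ ω, |X i ω| ∂P ≤ 1 := fun i => integral_abs_le_one (hX2 i) (h2 i).le
    have e2 : ∀ i, ∫ ω, (X i ω / q) ^ 2 ∂P = 1 / N := fun i => by
      simp_rw [div_pow]
      rw [integral_div, h2, hqq]
    have e3 : ∀ i, ∫ ω, |X i ω / q| ^ 3 ∂P = γ / q ^ 3 := fun i => by
      simp_rw [abs_div, abs_of_pos hq0, div_pow]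
      rw [integral_div, h3]
    have esum : ∀ (t : Finset ι) ω, ∑ i ∈ t, X i ω / q = (∑ i ∈ t, X i ω) / q := fun t ω =>
      (Finset.sum_div _ _ _).symm
    have hcard : ∀ i ∈ s, (s.erase i).card = n + 1 := fun i hi => by
      rw [Finset.card_erase_of_mem hi]; omega
    have hramp : ∀ y, |(∫ ω, ramp y (12 * η) ((∑ i ∈ s, X i ω) / q) ∂P)
        - ∫ t, ramp y (12 * η) t ∂(gaussianReal 0 1)|
          ≤ 2 * η * (7 + 120 * η / (12 * η)) := fun y => by
      have := abs_integral_ramp_sum_sub_le (P := P) (Z := fun i ω => X i ω / q)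
        (fun i => (hm i).div_const q)
        (hind.comp (fun _ x => x / q) fun _ => by fun_prop) s
        (fun i _ => by
          have : Integrable (fun ω => |X i ω| ^ 3) P :=
            (hX i).integrable_norm_pow (p := 3) (by norm_num)
          simpa only [abs_div, div_pow] using this.div_const (|q| ^ 3))
        (fun i _ => by rw [integral_div, h0, zero_div])
        (fun i _ => by
          -- The condition reduces to `E|X| ≤ γ`, true because `E|X| ≤ 1 ≤ γ`.
          rw [e2, e3]
          simp_rw [abs_div, abs_of_pos hq0]
          rw [integral_div, ← hqq, div_mul_div_comm, one_mul, ← pow_succ]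
          gcongr
          exact (habs1 i).trans hγ)
        (by
          simp_rw [e2]
          rw [Finset.sum_const, hs, nsmul_eq_mul, ← hN]
          field_simp)
        (fun i hi => by
          simp_rw [esum]
          refine integral_abs_le_one ?_ ?_
          · simp_rw [div_eq_mul_inv]
            exact (memLp_finsetSum (s.erase i) fun j _ => hX2 j).mul_const q⁻¹
          · simp_rw [div_pow]
            rw [integral_div, integral_sq_sum hX2 hind h0, Finset.sum_congr rfl fun i _ => h2 i,
              Finset.sum_const, hcard i hi, nsmul_eq_mul, mul_one, hqq, ← hM, div_le_one hN0]
            linarith)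
        -- The induction hypothesis gives the error `2 · 40 γ / r`, and `1 / r ≤ (3/2) / q`. The
        -- same ratio makes the coefficient of `b - a` at most `3/4`.
        (δ := 120 * η) (by positivity)
        (fun i hi a b hab => by
          have h4 := measureReal_mem_Ioc_le (P := P)
            (S := fun ω => (∑ j ∈ s.erase i, X j ω) / r) ((hS _).div_const r)
            (ih (s.erase i) (hcard i hi)) (a := a * q / r) (b := b * q / r) (by gcongr)
          have h5 : {ω | ∑ j ∈ s.erase i, X j ω / q ∈ Set.Ioc a b}
              = {ω | (∑ j ∈ s.erase i, X j ω) / r ∈ Set.Ioc (a * q / r) (b * q / r)} := by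
            ext ω
            simp only [Set.mem_ofPred_eq, Set.mem_Ioc, esum]
            rw [div_lt_div_iff_of_pos_right hr0, div_le_div_iff_of_pos_right hr0, lt_div_iff₀ hq0,
              div_le_iff₀ hq0]
          rw [h5]
          refine h4.trans (add_le_add ?_ ?_)
          · rw [← sub_div, ← sub_mul, div_div, div_le_iff₀ (by positivity)]
            have := mul_le_mul_of_nonneg_left hqr (sub_nonneg.2 hab)
            nlinarith [mul_nonneg (sub_nonneg.2 hab) hr0.le]
          · rw [hη, ← mul_div_assoc, ← mul_div_assoc, div_le_div_iff₀ hr0 hq0]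
            nlinarith)
        y (l := 12 * η) (by positivity)
      simp_rw [e3, esum] at this
      rw [Finset.sum_const, hs, nsmul_eq_mul, ← hN] at this
      have e4 : N * (γ / q ^ 3) = η := by
        rw [hη, ← hqq]; field_simp
      rwa [e4] at this
    refine (abs_measureReal_le_sub_stdNormalCDF_le ((hS s).div_const q) (by positivity) hramp
      z).trans ?_
    rw [mul_div_assoc 40, ← hη]
    -- The recursion closes: `6η` from smoothing at width `12η`, plus `2η (7 + 10) = 34η`.
    have : 120 * η / (12 * η) = 10 := by field_simp; norm_num
    rw [this]
    linarith

end Standardized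

/-! ### Passage to the product of the marginal laws. -/

section Transfer

variable {Ω : Type*} [MeasurableSpace Ω] {P : Measure Ω} {n : ℕ} {Z : Fin n → Ω → ℝ}

/-- On `Fin n → ℝ` the coordinates are genuinely measurable and the space lives in `Type`, the
universe of `IsBerryEsseenConstant`. -/
lemma measureReal_mem_eq_pi (hZ : ∀ i, AEMeasurable (Z i) P) (hind : iIndepFun Z P)
    {A : Set (Fin n → ℝ)} (hA : MeasurableSet A) :
    P.real {ω | (fun i => Z i ω) ∈ A} = (Measure.pi fun i => P.map (Z i)).real A := by
  rw [← hind.map_fun_eq_pi_map hZ, map_measureReal_apply_of_aemeasurable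
    (aemeasurable_pi_lambda _ hZ) hA]
  rfl

variable [IsProbabilityMeasure P]

lemma identDistrib_eval_pi (hZ : ∀ i, AEMeasurable (Z i) P) (i : Fin n) :
    IdentDistrib (fun y : Fin n → ℝ => y i) (Z i) (Measure.pi fun i => P.map (Z i)) P := by
  have : ∀ i, IsProbabilityMeasure (P.map (Z i)) := fun i =>
    Measure.isProbabilityMeasure_map (hZ i)
  exact ⟨(measurable_pi_apply i).aemeasurable, hZ i,
    (measurePreserving_eval (fun i => P.map (Z i)) i).map_eq⟩

lemma iIndepFun_eval_pi (hZ : ∀ i, AEMeasurable (Z i) P) :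
    iIndepFun (fun i (y : Fin n → ℝ) => y i) (Measure.pi fun i => P.map (Z i)) := by
  have : ∀ i, IsProbabilityMeasure (P.map (Z i)) := fun i =>
    Measure.isProbabilityMeasure_map (hZ i)
  exact iIndepFun_pi (X := fun _ x => x) fun _ => aemeasurable_id

end Transfer

theorem isBerryEsseenConstant_forty : IsBerryEsseenConstant 40 := by
  intro Ω _ P _ n hn Z hind hid hL3 h0 hvar x
  have hZ : ∀ i, AEMeasurable (Z i) P := fun i => (hL3 i).aestronglyMeasurable.aemeasurable
  set i₀ : Fin n := ⟨0, hn⟩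
  set σ := √Var[Z i₀; P] with hσ
  have hσ0 : 0 < σ := Real.sqrt_pos.2 hvar
  have hσσ : σ ^ 2 = Var[Z i₀; P] := Real.sq_sqrt hvar.le
  have hn0 : (0 : ℝ) < √(n : ℝ) := Real.sqrt_pos.2 (by exact_mod_cast hn)
  set Q := Measure.pi fun i => P.map (Z i) with hQ
  have : ∀ i, IsProbabilityMeasure (P.map (Z i)) := fun i =>
    Measure.isProbabilityMeasure_map (hZ i)
  have hidQ : ∀ i, IdentDistrib (fun y : Fin n → ℝ => y i / σ) (fun ω => Z i₀ ω / σ) Q P :=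
    fun i => ((identDistrib_eval_pi hZ i).trans (hid i i₀)).div_const σ
  have hLσ : MemLp (fun ω => Z i₀ ω / σ) 3 P := by
    simp_rw [div_eq_mul_inv]; exact (hL3 i₀).mul_const σ⁻¹
  obtain ⟨m, rfl⟩ : ∃ m, n = m + 1 := ⟨n - 1, by omega⟩
  have key := abs_measureReal_sum_le_sub_stdNormalCDF_le (P := Q)
    (X := fun i (y : Fin (m + 1) → ℝ) => y i / σ) (fun i => by fun_prop)
    (fun i => (hidQ i).symm.memLp_snd hLσ)
    ((iIndepFun_eval_pi hZ).comp (fun _ t => t / σ) fun _ => by fun_prop)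
    (fun i => by rw [(hidQ i).integral_eq, integral_div, h0, zero_div])
    (fun i => by
      rw [(hidQ i).sq.integral_eq]
      simp_rw [div_pow]
      rw [integral_div, ← variance_of_integral_eq_zero (hZ i₀) (h0 i₀), hσσ, div_self hvar.ne'])
    (γ := (∫ ω, |Z i₀ ω| ^ 3 ∂P) / σ ^ 3)
    (fun i => by
      have := ((hidQ i).norm.pow (n := 3)).integral_eq
      simp only [Real.norm_eq_abs] at this
      rw [this]
      simp_rw [abs_div, abs_of_pos hσ0, div_pow]
      rw [integral_div])
    m Finset.univ (by simp) x
  have hA : MeasurableSet {y : Fin (m + 1) → ℝ |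
      (∑ i, y i / σ) / √((m + 1 : ℕ) : ℝ) ≤ x} :=
    measurableSet_le (by fun_prop) measurable_const
  rw [← measureReal_mem_eq_pi hZ hind hA] at key
  have hset : {ω | √((m + 1 : ℕ) : ℝ) * ((∑ i, Z i ω) / ((m + 1 : ℕ) : ℝ)) / σ ≤ x}
      = {ω | (fun i => Z i ω) ∈ {y : Fin (m + 1) → ℝ |
        (∑ i, y i / σ) / √((m + 1 : ℕ) : ℝ) ≤ x}} := by
    ext ω
    simp only [Set.mem_ofPred_eq]
    rw [← Finset.sum_div]
    have hs : ((m + 1 : ℕ) : ℝ) = √((m + 1 : ℕ) : ℝ) ^ 2 :=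
      (Real.sq_sqrt (Nat.cast_nonneg _)).symm
    have : √((m + 1 : ℕ) : ℝ) * ((∑ i, Z i ω) / ((m + 1 : ℕ) : ℝ)) / σ
        = (∑ i, Z i ω) / σ / √((m + 1 : ℕ) : ℝ) := by
      nth_rewrite 2 [hs]
      field_simp
    rw [this]
  rw [hset]
  refine key.trans_eq ?_
  field_simp

/-- The Berry-Esseen inequality on an arbitrary probability space, for copies of a variable `V`. -/
lemma IsBerryEsseenConstant.abs_sub_le {c : ℝ} (hc : IsBerryEsseenConstant c) {Ω Ω₀ : Type*}
    [MeasurableSpace Ω] [MeasurableSpace Ω₀] {P : Measure Ω} [IsProbabilityMeasure P]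
    {P₀ : Measure Ω₀} {V : Ω₀ → ℝ} {n : ℕ} (hn : 0 < n)
    {Z : Fin n → Ω → ℝ} (hind : iIndepFun Z P) (hid : ∀ i, IdentDistrib (Z i) V P P₀)
    (hV : MemLp V 3 P₀) (h0 : ∫ ω, V ω ∂P₀ = 0) {σ : ℝ} (hσ : 0 < σ)
    (h2 : ∫ ω, V ω ^ 2 ∂P₀ = σ ^ 2) (x : ℝ) :
    |P.real {ω | (∑ i, Z i ω) / (√(n : ℝ) * σ) ≤ x} - stdNormalCDF x|
      ≤ c * (∫ ω, |V ω| ^ 3 ∂P₀) / (σ ^ 3 * √(n : ℝ)) := by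
  have hZ : ∀ i, AEMeasurable (Z i) P := fun i => (hid i).aemeasurable_fst
  have : ∀ i, IsProbabilityMeasure (P.map (Z i)) := fun i =>
    Measure.isProbabilityMeasure_map (hZ i)
  set Q := Measure.pi fun i => P.map (Z i) with hQ
  have hidQ : ∀ i, IdentDistrib (fun y : Fin n → ℝ => y i) V Q P₀ := fun i =>
    (identDistrib_eval_pi hZ i).trans (hid i)
  have hVar : Var[fun y : Fin n → ℝ => y ⟨0, hn⟩; Q] = σ ^ 2 := by
    rw [(hidQ _).variance_eq, variance_of_integral_eq_zero hV.aestronglyMeasurable.aemeasurable h0,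
      h2]
  have key := hc (Fin n → ℝ) Q n hn (fun i y => y i) (iIndepFun_eval_pi hZ)
    (fun i j => (hidQ i).trans (hidQ j).symm) (fun i => (hidQ i).symm.memLp_snd hV)
    (fun i => (hidQ i).integral_eq.trans h0) (by rw [hVar]; positivity) x
  have h3 : ∫ y : Fin n → ℝ, |y ⟨0, hn⟩| ^ 3 ∂Q = ∫ ω, |V ω| ^ 3 ∂P₀ := by
    have := ((hidQ ⟨0, hn⟩).norm.pow (n := 3)).integral_eq
    simpa only [Real.norm_eq_abs] using this
  rw [hVar, Real.sqrt_sq hσ.le, h3] at key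
  have hA : MeasurableSet {y : Fin n → ℝ | √(n : ℝ) * ((∑ i, y i) / n) / σ ≤ x} :=
    measurableSet_le (by fun_prop) measurable_const
  rw [← measureReal_mem_eq_pi hZ hind hA] at key
  have hset : {ω | (∑ i, Z i ω) / (√(n : ℝ) * σ) ≤ x}
      = {ω | (fun i => Z i ω) ∈ {y : Fin n → ℝ | √(n : ℝ) * ((∑ i, y i) / n) / σ ≤ x}} := by
    ext ω
    simp only [Set.mem_ofPred_eq]
    have hn0 : 0 < √(n : ℝ) := Real.sqrt_pos.2 (by exact_mod_cast hn)
    have hs : (n : ℝ) = √(n : ℝ) ^ 2 := (Real.sq_sqrt (Nat.cast_nonneg _)).symm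
    have : √(n : ℝ) * ((∑ i, Z i ω) / n) / σ = (∑ i, Z i ω) / (√(n : ℝ) * σ) := by
      nth_rewrite 2 [hs]
      field_simp
    rw [this]
  rw [hset]
  exact key

/-! ### Small perturbations of an approximately Gaussian variable. -/

section Perturbation

variable {Ω : Type*} [MeasurableSpace Ω] {P : Measure Ω} [IsProbabilityMeasure P]

lemma measureReal_lt_abs_le {G : Ω → ℝ} (hG : AEMeasurable G P) {Δ : ℝ}
    (h : ∀ x, |P.real {ω | G ω ≤ x} - stdNormalCDF x| ≤ Δ) {t : ℝ} (ht : 0 ≤ t) :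
    P.real {ω | t < |G ω|} ≤ Real.exp (-t ^ 2 / 2) + 2 * Δ := by
  have h1 := abs_le.1 (h t)
  have h2 := abs_le.1 (h (-t))
  have h3 := stdNormalCDF_neg_le ht
  have h4 := stdNormalCDF_neg t
  have hsub : {ω | t < |G ω|} ⊆ {ω | G ω ≤ t}ᶜ ∪ {ω | G ω ≤ -t} := fun ω (hω : t < |G ω|) => by
    rcases lt_abs.1 hω with h | h
    · exact Or.inl (not_le.2 h)
    · exact Or.inr (by simp only [Set.mem_ofPred_eq]; linarith)
  have h5 := (measureReal_mono (μ := P) hsub).trans (measureReal_union_le _ _)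
  have h6 : P.real {ω | G ω ≤ t}ᶜ = 1 - P.real {ω | G ω ≤ t} := by
    rw [Measure.real, prob_compl_eq_one_sub₀ (nullMeasurableSet_le hG aemeasurable_const),
      ENNReal.toReal_sub_of_le prob_le_one ENNReal.one_ne_top]
    rfl
  linarith

/-- Up to `B`, the event `T ≤ x` lies between `A ≤ x - r` and `A ≤ x + r`. No independence between
`A` and `B` is needed. -/
lemma abs_measureReal_sub_stdNormalCDF_le_of_close {A T : Ω → ℝ} {Δ r : ℝ}
    (h : ∀ x, |P.real {ω | A ω ≤ x} - stdNormalCDF x| ≤ Δ) (hr : 0 ≤ r) {B : Set Ω}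
    (hB : ∀ ω, ω ∉ B → |T ω - A ω| ≤ r) (x : ℝ) :
    |P.real {ω | T ω ≤ x} - stdNormalCDF x| ≤ Δ + r / √(2 * Real.pi) + P.real B := by
  have s1 : {ω | T ω ≤ x} ⊆ {ω | A ω ≤ x + r} ∪ B := fun ω (hω : T ω ≤ x) => by
    by_cases hb : ω ∈ B
    · exact Or.inr hb
    · have := abs_le.1 (hB ω hb)
      exact Or.inl (by simp only [Set.mem_ofPred_eq]; linarith)
  have s2 : {ω | A ω ≤ x - r} ⊆ {ω | T ω ≤ x} ∪ B := fun ω (hω : A ω ≤ x - r) => by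
    by_cases hb : ω ∈ B
    · exact Or.inr hb
    · have := abs_le.1 (hB ω hb)
      exact Or.inl (by simp only [Set.mem_ofPred_eq]; linarith)
  have h1 := (measureReal_mono (μ := P) s1).trans (measureReal_union_le _ _)
  have h2 := (measureReal_mono (μ := P) s2).trans (measureReal_union_le _ _)
  have h3 := abs_le.1 (h (x + r))
  have h4 := abs_le.1 (h (x - r))
  have h5 := stdNormalCDF_sub_le (a := x) (b := x + r) (by linarith)
  have h6 := stdNormalCDF_sub_le (a := x - r) (b := x) (by linarith)
  rw [add_sub_cancel_left] at h5
  rw [sub_sub_cancel] at h6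
  rw [abs_le]
  constructor <;> linarith

end Perturbation

/-! ### Moments of the regression variables. -/

section Regression

variable {Ω : Type*} [MeasurableSpace Ω] {P : Measure Ω} {X Y : Ω → ℝ}

lemma lpNorm_two_sq {f : Ω → ℝ} (hf : AEStronglyMeasurable f P) :
    lpNorm f 2 P ^ 2 = ∫ ω, f ω ^ 2 ∂P := by
  rw [lpNorm_eq_integral_norm_rpow_toReal (by norm_num) (by norm_num) hf, ← Real.rpow_natCast,
    ← Real.rpow_mul (integral_nonneg fun ω => by positivity)]
  simp

lemma lpNorm_three_pow {f : Ω → ℝ} (hf : AEStronglyMeasurable f P) :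
    lpNorm f 3 P ^ 3 = ∫ ω, |f ω| ^ 3 ∂P := by
  rw [lpNorm_eq_integral_norm_rpow_toReal (by norm_num) (by norm_num) hf, ← Real.rpow_natCast,
    ← Real.rpow_mul (integral_nonneg fun ω => by positivity)]
  simp only [ENNReal.toReal_ofNat, Nat.cast_ofNat, ne_eq, OfNat.ofNat_ne_zero, not_false_eq_true,
    inv_mul_cancel₀, Real.rpow_one, Real.norm_eq_abs]
  exact integral_congr_ae (Filter.Eventually.of_forall fun ω => by norm_cast)

lemma memLp_centered [IsProbabilityMeasure P] {p : ENNReal} (hX : MemLp X p P) :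
    MemLp (centered X P) p P :=
  hX.sub (memLp_const _)

lemma memLp_regressionError [IsProbabilityMeasure P] {p : ENNReal} (hX : MemLp X p P)
    (hY : MemLp Y p P) :
    MemLp (regressionError X Y P) p P :=
  (memLp_centered hY).sub ((memLp_centered hX).const_mul (regressionSlope X Y P))

lemma integral_centered [IsProbabilityMeasure P] (hX : Integrable X P) : ∫ ω, centered X P ω ∂P = 0 := by
  unfold centered
  rw [integral_sub hX (integrable_const _)]
  simp

lemma integral_regressionError [IsProbabilityMeasure P] (hX : Integrable X P) (hY : Integrable Y P) :
    ∫ ω, regressionError X Y P ω ∂P = 0 := by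
  have h1 : Integrable (centered X P) P := hX.sub (integrable_const _)
  have h2 : Integrable (centered Y P) P := hY.sub (integrable_const _)
  have : ∫ ω, regressionError X Y P ω ∂P
      = ∫ ω, (centered Y P ω - regressionSlope X Y P * centered X P ω) ∂P := rfl
  rw [this, integral_sub h2 (h1.const_mul _), integral_const_mul, integral_centered hX,
    integral_centered hY]
  simp

lemma integral_centered_sq (hX : MemLp X 2 P) :
    ∫ ω, centered X P ω ^ 2 ∂P = stdDev X P ^ 2 := by
  rw [stdDev, Real.sq_sqrt (variance_nonneg _ _),
    variance_eq_integral hX.aestronglyMeasurable.aemeasurable]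
  rfl

lemma integral_regressionError_sq [IsProbabilityMeasure P] (hX : MemLp X 2 P)
    (hY : MemLp Y 2 P) :
    ∫ ω, regressionError X Y P ω ^ 2 ∂P = stdDev (regressionError X Y P) P ^ 2 := by
  have h := memLp_regressionError hX hY
  rw [← integral_centered_sq h]
  simp [centered, integral_regressionError (hX.integrable one_le_two) (hY.integrable one_le_two)]

/-- The expectation equals `Cov(Y, X) - τ Var X`, which the choice of `τ` makes zero. -/
lemma integral_centeredMulError [IsProbabilityMeasure P] (hX : MemLp X 2 P)
    (hY : MemLp Y 2 P) (hV : Var[X; P] ≠ 0) :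
    ∫ ω, centeredMulError X Y P ω ∂P = 0 := by
  have hx := memLp_centered hX
  have hy := memLp_centered hY
  have h1 : Integrable (fun ω => centered Y P ω * centered X P ω) P := hy.integrable_mul hx
  have h2 : ∫ ω, centeredMulError X Y P ω ∂P = ∫ ω, (centered Y P ω * centered X P ω
      - regressionSlope X Y P * centered X P ω ^ 2) ∂P :=
    integral_congr_ae (Filter.Eventually.of_forall fun ω => by
      simp only [centeredMulError, regressionError, errorAt, centered]; ring)
  have h3 : ∫ ω, centered Y P ω * centered X P ω ∂P = cov[Y, X; P] := rfl
  rw [h2, integral_sub h1 (hx.integrable_sq.const_mul _), integral_const_mul,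
    integral_centered_sq hX, h3, stdDev, Real.sq_sqrt (variance_nonneg _ _), regressionSlope,
    div_mul_cancel₀ _ hV, sub_self]

lemma ae_eq_zero_of_integral_sq_eq_zero {f : Ω → ℝ} (hf : MemLp f 2 P)
    (h : ∫ ω, f ω ^ 2 ∂P = 0) : f =ᵐ[P] 0 := by
  have := (integral_eq_zero_iff_of_nonneg (fun ω => sq_nonneg (f ω)) hf.integrable_sq).1 h
  filter_upwards [this] with ω hω
  exact pow_eq_zero_iff two_ne_zero |>.1 hω

lemma stdDev_pos_of_centeredMulError_ne_zero [IsProbabilityMeasure P] (hX : MemLp X 2 P)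
    (hY : MemLp Y 2 P)
    (h : ¬ centeredMulError X Y P =ᵐ[P] 0) :
    0 < stdDev X P ∧ 0 < stdDev (regressionError X Y P) P := by
  refine ⟨(Real.sqrt_nonneg _).lt_of_ne' fun h0 => h ?_,
    (Real.sqrt_nonneg _).lt_of_ne' fun h0 => h ?_⟩
  · have := ae_eq_zero_of_integral_sq_eq_zero (memLp_centered hX)
      (by rw [integral_centered_sq hX, stdDev, h0]; norm_num)
    filter_upwards [this] with ω hω
    simp [centeredMulError, hω]
  · have := ae_eq_zero_of_integral_sq_eq_zero (memLp_regressionError hX hY)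
      (by rw [integral_regressionError_sq hX hY, stdDev, h0]; norm_num)
    filter_upwards [this] with ω hω
    simp [centeredMulError, hω]

end Regression

/-! ### The decomposition of the statistic and the main bound. -/

lemma sum_sub_sampleMean_mul {n : ℕ} (x e : Fin n → ℝ) (m : ℝ) :
    ∑ i, (x i - sampleMean x) * e i
      = (∑ i, (x i - m) * e i) - (∑ i, (x i - m)) * (∑ i, e i) / n := by
  rcases Nat.eq_zero_or_pos n with rfl | hn
  · simp
  have hn0 : (n : ℝ) ≠ 0 := by positivity
  have h1 : sampleMean x - m = (∑ i, (x i - m)) / n := by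
    rw [sampleMean, Finset.sum_sub_distrib]
    simp
    field_simp
  have h2 : ∀ i, (x i - sampleMean x) * e i = (x i - m) * e i - (sampleMean x - m) * e i :=
    fun i => by ring
  simp_rw [h2]
  rw [Finset.sum_sub_distrib, ← Finset.mul_sum, h1]
  ring

lemma measurable_errorAt {Ω : Type*} [MeasurableSpace Ω] (X Y : Ω → ℝ) (P : Measure Ω) :
    Measurable fun p : ℝ × ℝ => errorAt X Y P p.1 p.2 := by
  unfold errorAt
  fun_prop

theorem mainTheorem4 :
    (∃ c : ℝ, IsBerryEsseenConstant c) ∧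
    ∀ c : ℝ, IsBerryEsseenConstant c →
      ∀ {Ω₀ : Type*} [MeasurableSpace Ω₀] (P₀ : Measure Ω₀) [IsProbabilityMeasure P₀]
        {Ω : Type*} [MeasurableSpace Ω] (P : Measure Ω) [IsProbabilityMeasure P]
        (X Y : Ω₀ → ℝ) (n : ℕ) (_ : 1 ≤ n) (Xs Ys : Fin n → Ω → ℝ),
        -- finiteness of the moments in `K₁` and `K₂`, non-vanishing of their denominators
        MemLp X 3 P₀ → MemLp Y 3 P₀ → MemLp (centeredMulError X Y P₀) 3 P₀ →
        ¬ (centeredMulError X Y P₀ =ᵐ[P₀] 0) →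
        -- `(X_i, Y_i)`, `i = 1, …, n`, are independent copies of `(X, Y)`
        iIndepFun (fun i ω => (Xs i ω, Ys i ω)) P →
        (∀ i, IdentDistrib (fun ω => (Xs i ω, Ys i ω)) (fun ω => (X ω, Y ω)) P P₀) →
        (⨆ x : ℝ,
          |P.real {ω |
              (∑ i, (Xs i ω - sampleMean (fun k => Xs k ω)) * errorAt X Y P₀ (Xs i ω) (Ys i ω)) /
                √(n * lpNorm (centeredMulError X Y P₀) 2 P₀ ^ 2) ≤ x}
            - stdNormalCDF x|)
          ≤ Real.log n / √(n : ℝ) * momentK₁ X Y P₀ + momentK₂ c X Y P₀ / √(n : ℝ) := by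
  refine ⟨⟨40, isBerryEsseenConstant_forty⟩, ?_⟩
  intro c hc Ω₀ _ P₀ _ Ω _ P _ X Y n hn Xs Ys hX3 hY3 hV3 hVne hind hid
  have hX2 : MemLp X 2 P₀ := hX3.mono_exponent (by norm_num)
  have hY2 : MemLp Y 2 P₀ := hY3.mono_exponent (by norm_num)
  have hV2 : MemLp (centeredMulError X Y P₀) 2 P₀ := hV3.mono_exponent (by norm_num)
  have hXi := hX2.integrable one_le_two
  have hYi := hY2.integrable one_le_two
  obtain ⟨hσx, hσe⟩ := stdDev_pos_of_centeredMulError_ne_zero hX2 hY2 hVne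
  set σx := stdDev X P₀ with hσx_def
  set σe := stdDev (regressionError X Y P₀) P₀ with hσe_def
  set s := lpNorm (centeredMulError X Y P₀) 2 P₀ with hs_def
  have hs : 0 < s := lpNorm_nonneg.lt_of_ne'
    fun h0 => hVne ((lpNorm_eq_zero hV2 two_ne_zero).1 h0)
  have hvar : Var[X; P₀] ≠ 0 := fun h0 => hσx.ne' (by rw [hσx_def, stdDev, h0, Real.sqrt_zero])
  have hn1 : (1 : ℝ) ≤ n := by exact_mod_cast hn
  have hn0 : (0 : ℝ) < n := by linarith
  set q := √(n : ℝ) with hq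
  have hq0 : 0 < q := Real.sqrt_pos.2 hn0
  have hqq : q ^ 2 = n := Real.sq_sqrt hn0.le
  set m := ∫ ω, X ω ∂P₀ with hm
  have hmeas := measurable_errorAt X Y P₀
  have hmx : Measurable fun p : ℝ × ℝ => p.1 - m := by fun_prop
  have hmv : Measurable fun p : ℝ × ℝ => (p.1 - m) * errorAt X Y P₀ p.1 p.2 := hmx.mul hmeas
  have hidV : ∀ i, IdentDistrib (fun ω => (Xs i ω - m) * errorAt X Y P₀ (Xs i ω) (Ys i ω))
      (centeredMulError X Y P₀) P P₀ := fun i => (hid i).comp hmv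
  have hidX : ∀ i, IdentDistrib (fun ω => Xs i ω - m) (centered X P₀) P P₀ :=
    fun i => (hid i).comp hmx
  have hidE : ∀ i, IdentDistrib (fun ω => errorAt X Y P₀ (Xs i ω) (Ys i ω))
      (regressionError X Y P₀) P P₀ := fun i => (hid i).comp hmeas
  have hE3 := memLp_regressionError hX3 hY3
  have hC3 := memLp_centered hX3
  have beV := hc.abs_sub_le hn (hind.comp (fun _ p => (p.1 - m) * errorAt X Y P₀ p.1 p.2)
    fun _ => hmv) hidV hV3 (integral_centeredMulError hX2 hY2 hvar) hs
    (lpNorm_two_sq hV3.aestronglyMeasurable).symm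
  have beX := hc.abs_sub_le hn (hind.comp (fun _ p => p.1 - m) fun _ => hmx) hidX hC3
    (integral_centered hXi) hσx (integral_centered_sq hX2)
  have beE := hc.abs_sub_le hn (hind.comp (fun _ p => errorAt X Y P₀ p.1 p.2)
    fun _ => hmeas) hidE hE3 (integral_regressionError hXi hYi) hσe
    (integral_regressionError_sq hX2 hY2)
  rw [← lpNorm_three_pow hV3.aestronglyMeasurable] at beV
  rw [← lpNorm_three_pow hC3.aestronglyMeasurable] at beX
  rw [← lpNorm_three_pow hE3.aestronglyMeasurable] at beE
  simp only [Function.comp_apply] at beV beX beE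
  set G : Ω → ℝ := fun ω => (∑ i, (Xs i ω - m)) / (q * σx) with hG
  set H : Ω → ℝ := fun ω => (∑ i, errorAt X Y P₀ (Xs i ω) (Ys i ω)) / (q * σe) with hH
  have hGm : AEMeasurable G P :=
    (Finset.aemeasurable_fun_sum _ fun i _ => (hidX i).aemeasurable_fst).div_const _
  have hHm : AEMeasurable H P :=
    (Finset.aemeasurable_fun_sum _ fun i _ => (hidE i).aemeasurable_fst).div_const _
  have hlog : 0 ≤ Real.log n := Real.log_nonneg hn1
  -- This threshold balances the two costs: `exp (-t² / 2) = 1 / √n`, while `|G H| ≤ t² = log n` off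
  -- the tails.
  set t := √(Real.log n) with ht
  have htt : t ^ 2 = Real.log n := Real.sq_sqrt hlog
  have hexp : Real.exp (-t ^ 2 / 2) = 1 / q := by
    rw [htt, hq, Real.sqrt_eq_rpow, Real.rpow_def_of_pos hn0, one_div, ← Real.exp_neg]
    ring_nf
  have tailX := measureReal_lt_abs_le hGm beX (Real.sqrt_nonneg (Real.log n))
  have tailE := measureReal_lt_abs_le hHm beE (Real.sqrt_nonneg (Real.log n))
  rw [← ht, hexp] at tailX tailE
  have hden : √(n * s ^ 2) = q * s := by rw [Real.sqrt_mul hn0.le, Real.sqrt_sq hs.le]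
  have hr : 0 ≤ σx * σe / (s * q) * Real.log n := by positivity
  refine ciSup_le fun x => ?_
  rw [hden]
  refine (abs_measureReal_sub_stdNormalCDF_le_of_close beV hr
    (B := {ω | t < |G ω|} ∪ {ω | t < |H ω|}) (fun ω hω => ?_) x).trans ?_
  · simp only [Set.mem_union, Set.mem_ofPred_eq, not_or, not_lt] at hω
    rw [sum_sub_sampleMean_mul (fun i => Xs i ω) _ m, ← sub_div, sub_sub_cancel_left]
    have e : -((∑ i, (Xs i ω - m)) * (∑ i, errorAt X Y P₀ (Xs i ω) (Ys i ω)) / n) / (q * s)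
        = -(σx * σe / (s * q) * (G ω * H ω)) := by
      simp only [hG, hH]
      rw [← hqq]
      field_simp
    rw [e, abs_neg, abs_mul, abs_of_pos (by positivity : 0 < σx * σe / (s * q)), abs_mul, ← htt,
      pow_two t]
    gcongr
    · exact hω.1
    · exact hω.2
  -- The two terms `1 / √n` give the 2 in `K₂`; the doubled errors of `G` and `H` give its factors
  -- 2.
  · refine (add_le_add_right ((measureReal_union_le _ _).trans (add_le_add tailX tailE)) _).trans_eq
      ?_
    simp only [momentK₁, momentK₂, ← hσx_def, ← hσe_def, ← hs_def]
    field_simp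
    ring
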